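/- Fix an integer $k\ge 1$. For each $n\in\mathbb N$ let $\mathbf y=\mathbf y_n=(y_1,\dots,y_n)$ be a random vector in $\mathbb R^n$ which is normalized isotropic, i.e. $\mathbf E\{y_j\}=0$ and $\mathbf E\{y_iy_j\}=\delta_{ij}n^{-1}$, and whose distribution is unconditional, i.e. $(\pm y_1,\dots,\pm y_n)$ has the same distribution as $\mathbf y$ for every choice of signs. Assume that its fourth moments are finite for all large $n$ and that, as $n\to\infty$, uniformly in $i\ne j$, $$a_{2,2}:=\mathbf E\{y_i^2y_j^2\}=n^{-2}+O(n^{-3}),\qquad \kappa_4:=\mathbf E\{y_j^4\}-3a_{2,2}=O(n^{-2}).$$ Let $m=m(n)$ be positive integers with $m\to\infty$ and $m/n^k\to c\in(0,\infty)$ as $n\to\infty$. For every $m$ let $\{\tau_\alpha\}_{\alpha=1}^m=\{\tau^{(m)}_\alpha\}_{\alpha=1}^m$ be real numbers whose normalized counting measures $\sigma_m=m^{-1}\sum_{\alpha=1}^m\delta_{\tau_\alpha}$ converge weakly, as $m\to\infty$, to a probability measure $\sigma$ on $\mathbb R$ and satisfy $\sup_m\int\tau^4\,d\sigma_m(\tau)<\infty$.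 Let $\mathbf y_\alpha^{(j)}$, $1\le\alpha\le m$, $1\le j\le k$, be i.i.d. copies of $\mathbf y$, put $Y_\alpha=\mathbf y_\alpha^{(1)}\otimes\dots\otimes\mathbf y_\alpha^{(k)}$, and consider the $n^k\times n^k$ real symmetric random matrix $$\mathcal M_n=\sum_{\alpha=1}^m\tau_\alpha Y_\alpha Y_\alpha^T$$ with eigenvalues $\lambda_1^{(n)},\dots,\lambda_{n^k}^{(n)}$ (counted with multiplicity) and its linear eigenvalue statistics $\mathcal N_n[\varphi]=\sum_{j=1}^{n^k}\varphi(\lambda_j^{(n)})$. For $s>5/2$ let $\mathcal H_s$ be the Sobolev space of (continuous) functions $\varphi:\mathbb R\to\mathbb R$ in $L^2(\mathbb R)$ with $$\|\varphi\|_s^2=\int(1+|t|)^{2s}|\widehat\varphi(t)|^2\,dt<\infty,\qquad \widehat\varphi(t)=\int e^{it\theta}\varphi(\theta)\,d\theta .$$ Then for every $s>5/2$ there is a constant $C$, independent of $n$ and $\varphi$, such that for all sufficiently large $n$ and all $\varphi\in\mathcal H_s$ the random variable $\mathcal N_n[\varphi]$ is square integrable and $$\mathbf{Var}\{\mathcal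 N_n[\varphi]\}\le C\,n^{k-1}\,\|\varphi\|_s^2 .$$ -/

import Mathlib

open MeasureTheory ProbabilityTheory Filter Topology

noncomputable section

/-- The normalized counting measure of a finite family of reals, counted with multiplicity. -/
def normalizedCountingMeasure {ι : Type*} [Fintype ι] (x : ι → ℝ) : Measure ℝ :=
  (Fintype.card ι : ENNReal)⁻¹ • ∑ i, Measure.dirac (x i)

/-- A law on `ℝⁿ` is normalized isotropic if `E y_j = 0` and `E y_i y_j = δ_{ij} / n`. -/
structure IsNormalizedIsotropic {n : ℕ} (μ : Measure (Fin n → ℝ)) : Prop where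
  memLp : ∀ j, MemLp (fun y : Fin n → ℝ => y j) 2 μ
  mean : ∀ j, ∫ y, y j ∂μ = 0
  cov : ∀ i j, ∫ y, y i * y j ∂μ = if i = j then (n : ℝ)⁻¹ else 0

/-- A law on `ℝⁿ` is unconditional if it is invariant under all changes of signs of the
coordinates. -/
def IsUnconditional {n : ℕ} (μ : Measure (Fin n → ℝ)) : Prop :=
  ∀ ε : Fin n → ℤˣ, μ.map (fun y i => ((ε i : ℤ) : ℝ) * y i) = μ

/-- The mixed fourth moment `a_{2,2} = E y_i² y_j²` (for `i ≠ j`). -/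
def a22 {n : ℕ} (μ : Measure (Fin n → ℝ)) (i j : Fin n) : ℝ :=
  ∫ y, y i ^ 2 * y j ^ 2 ∂μ

/-- The quantity `κ₄ = E y_j⁴ - 3 a_{2,2}` (for `i ≠ j`). -/
def kappa4 {n : ℕ} (μ : Measure (Fin n → ℝ)) (i j : Fin n) : ℝ :=
  (∫ y, y j ^ 4 ∂μ) - 3 * a22 μ i j

/-- `a_{2,2} = n⁻² + O(n⁻³)` and `κ₄ = O(n⁻²)` as `n → ∞`, uniformly in the coordinates. (When
these moments do not depend on the chosen coordinates, uniformity is automatic.) The fourth moments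
are required to be finite for all large `n`. -/
def FourthMomentAsymptotics (μ : ∀ n : ℕ, Measure (Fin n → ℝ)) : Prop :=
  ∃ C : ℝ, ∀ᶠ n : ℕ in atTop,
    (∀ j, Integrable (fun y : Fin n → ℝ => y j ^ 4) (μ n)) ∧
    ∀ i j : Fin n, i ≠ j →
      |a22 (μ n) i j - (n : ℝ) ^ (-2 : ℤ)| ≤ C * (n : ℝ) ^ (-3 : ℤ) ∧
      |kappa4 (μ n) i j| ≤ C * (n : ℝ) ^ (-2 : ℤ)

/-- The tensor product `y⁽¹⁾ ⊗ ⋯ ⊗ y⁽ᵏ⁾`, with components indexed by multi-indices. -/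
def tensorVec {k n : ℕ} (y : Fin k → Fin n → ℝ) : (Fin k → Fin n) → ℝ :=
  fun j => ∏ i, y i (j i)

/-- The `nᵏ × nᵏ` matrix `∑_α τ_α Y_α Y_αᵀ` with `Y_α = y_α⁽¹⁾ ⊗ ⋯ ⊗ y_α⁽ᵏ⁾`. -/
def tensorCov {k m n : ℕ} (τ : Fin m → ℝ) (y : Fin m → Fin k → Fin n → ℝ) :
    Matrix (Fin k → Fin n) (Fin k → Fin n) ℝ :=
  ∑ α, τ α • Matrix.vecMulVec (tensorVec (y α)) (tensorVec (y α))

theorem tensorCov_isHermitian {k m n : ℕ} (τ : Fin m → ℝ) (y : Fin m → Fin k → Fin n → ℝ) :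
    (tensorCov τ y).IsHermitian := by
  ext i j
  simp [tensorCov, Matrix.sum_apply, Matrix.vecMulVec_apply, mul_comm]

/-- The linear eigenvalue statistic: the sum of `φ` over the eigenvalues of `tensorCov τ y`,
counted with multiplicity. -/
def linearStat {k m n : ℕ} (φ : ℝ → ℝ) (τ : Fin m → ℝ) (y : Fin m → Fin k → Fin n → ℝ) : ℝ :=
  ∑ j, φ ((tensorCov_isHermitian τ y).eigenvalues j)

/-- The Fourier transform `φ̂(t) = ∫ e^{itθ} φ(θ) dθ` of a square-integrable function, in the sense
of Plancherel. Mathlib's `𝓕` is normalized as `∫ e^{-2πiwθ} φ(θ) dθ`, so it is evaluated at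
`w = -t / (2π)`. -/
def fourierHat (φ : ℝ → ℝ) (hφ : MemLp (fun x => (φ x : ℂ)) 2 (volume : Measure ℝ)) (t : ℝ) : ℂ :=
  (FourierTransform.fourier (hφ.toLp (fun x => (φ x : ℂ))) : Lp ℂ 2 (volume : Measure ℝ))
    (-t / (2 * Real.pi))

/-- The squared Sobolev norm `‖φ‖_s² = ∫ (1 + |t|)^{2s} |φ̂(t)|² dt`. -/
def sobolevNormSq (s : ℝ) (φ : ℝ → ℝ)
    (hφ : MemLp (fun x => (φ x : ℂ)) 2 (volume : Measure ℝ)) : ℝ :=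
  ∫ t, (1 + |t|) ^ (2 * s) * ‖fourierHat φ hφ t‖ ^ 2

/-- `φ` belongs to the Sobolev space `H_s`. For `s > 1/2` each class in `H_s` has exactly one
continuous representative; it is the one whose values at points are meant. -/
structure MemSobolevH (s : ℝ) (φ : ℝ → ℝ) : Prop where
  continuous : Continuous φ
  memLp : MemLp (fun x => (φ x : ℂ)) 2 (volume : Measure ℝ)
  integrable : Integrable (fun t => (1 + |t|) ^ (2 * s) * ‖fourierHat φ memLp t‖ ^ 2)

end

/-! Write u(t) = Tr exp(it𝓜) for the random matrix 𝓜. Fourier inversion gives 𝓝[φ] = (2π)⁻¹ ∫ u(-t)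
φ̂(t) dt, so a weighted Cauchy–Schwarz inequality bounds the variance by ‖φ‖_s² ∫ (1 + |t|)^{-2s}
E|u(-t) - E u(-t)|² dt. It is therefore enough that u(t) has variance O((1 + |t|)⁴ n^{k-1}); the
remaining integral of (1 + |t|)^{4-2s} converges because s > 5/2.

By the Efron–Stein inequality (`variance_pi_le`) the variance of u(t) is at most a sum over α of
conditional variances in Y_α alone, and each of these is O((t²τ_α² + t⁴τ_α⁴)/n). Since m = O(n^k)
and ∑ τ_α⁴ = O(m), the sum has the required order.

For a single summand the matrix is A + τ Y Yᵀ with A independent of Y. The trace is compared with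
its value at a deterministic unit vector v whose spectral measure with respect to A is the
normalized counting measure of the eigenvalues. Rotating v into Y and applying Duhamel's formula
along the rotation (`norm_trace_propagator_sub_le_of_orthogonal`) bounds the difference by the
deviations Yᵀ exp(isA) Y - n^{-k} Tr exp(isA), 0 ≤ s ≤ 1. The rotation argument needs v and Y to
have no mixed spectral measure; placing them in different copies of the space, with A ⊕ A acting,
ensures this at no cost (`norm_trace_propagator_sub_le_of_two`).

Finally, these deviations have mean square O(1/n) because exp(isA) is unitary. For one vector this
is a fourth moment computation in which unconditionality leaves only paired indices
(`lintegral_quadForm_sub_le`). For k factors it follows by induction: conditionally on the other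
factors the form is quadratic in the first one, and its conditional mean is the form of a partial
trace in the remaining ones (`lintegral_tensor_quadForm_sub_le`). -/

/-! ### Fourth moments and quadratic forms of one vector -/

theorem IsUnconditional.integral_eq_zero {n : ℕ} {μ : Measure (Fin n → ℝ)}
    (hμ : IsUnconditional μ) {f : (Fin n → ℝ) → ℝ} (hf : Measurable f) (ε : Fin n → ℤˣ)
    (h : ∀ y, f (fun i => ((ε i : ℤ) : ℝ) * y i) = -f y) : ∫ y, f y ∂μ = 0 := by
  have hmeas : Measurable (fun (y : Fin n → ℝ) i => ((ε i : ℤ) : ℝ) * y i) := by fun_prop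
  have h1 : ∫ y, f y ∂μ = -∫ y, f y ∂μ := by
    conv_lhs => rw [← hμ ε]
    rw [integral_map hmeas.aemeasurable hf.aestronglyMeasurable]
    simp only [h, integral_neg]
  linarith

theorem integrable_quartic_monomial {n : ℕ} {μ : Measure (Fin n → ℝ)}
    (h4 : ∀ j, Integrable (fun y : Fin n → ℝ => y j ^ 4) μ) (i j k l : Fin n) :
    Integrable (fun y : Fin n → ℝ => y i * y j * (y k * y l)) μ := by
  refine Integrable.mono' (((h4 i).add (h4 j)).add ((h4 k).add (h4 l)))
    (by fun_prop) (ae_of_all _ fun y => ?_)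
  rw [Real.norm_eq_abs, abs_le]
  simp only [Pi.add_apply]
  constructor <;>
  nlinarith [sq_nonneg (y i * y j + y k * y l), sq_nonneg (y i * y j - y k * y l),
    sq_nonneg (y i ^ 2 - y j ^ 2), sq_nonneg (y k ^ 2 - y l ^ 2), sq_nonneg (y i ^ 2),
    sq_nonneg (y j ^ 2), sq_nonneg (y k ^ 2), sq_nonneg (y l ^ 2)]

/-- Because i ≠ j, unless {k, l} = {i, j} one of y_i, y_j occurs to the first power only, and
flipping its sign changes the sign of the monomial. -/
theorem integral_quartic_monomial_eq {n : ℕ} {μ : Measure (Fin n → ℝ)}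
    (hμ : IsUnconditional μ) {i j : Fin n} (hij : i ≠ j) (k l : Fin n) :
    ∫ y, y i * y j * (y k * y l) ∂μ =
      if (k = i ∧ l = j) ∨ (k = j ∧ l = i) then a22 μ i j else 0 := by
  split_ifs with h
  · unfold a22
    congr 1
    ext y
    rcases h with ⟨rfl, rfl⟩ | ⟨rfl, rfl⟩ <;> ring
  · have key : ∀ p : Fin n, (∀ y : Fin n → ℝ,
        (fun y : Fin n → ℝ => y i * y j * (y k * y l))
          (fun q => (((Function.update (1 : Fin n → ℤˣ) p (-1)) q : ℤ) : ℝ) * y q) =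
        -(y i * y j * (y k * y l))) → ∫ y, y i * y j * (y k * y l) ∂μ = 0 :=
      fun p hp => hμ.integral_eq_zero (by fun_prop) _ hp
    by_cases hi : k = i ∨ l = i
    · apply key j
      intro y
      have h1 : k ≠ j := by grind
      have h2 : l ≠ j := by grind
      simp [Function.update_of_ne, hij, h1, h2]
    · push Not at hi
      apply key i
      intro y
      simp [Function.update_of_ne, hij.symm, hi.1, hi.2]

/-- The hypothesis says that the squared operator norm of B is at most κ, in a form that passes
easily to slices and partial traces. Testing it on a column and the corresponding basis vector gives
S² ≤ κ S for the squared length S of the column. -/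
theorem sum_sq_col_le {ι : Type*} [Fintype ι] [DecidableEq ι] {B : Matrix ι ι ℝ} {κ : ℝ}
    (hB : ∀ x y : ι → ℝ, (x ⬝ᵥ B.mulVec y) ^ 2 ≤ κ * (x ⬝ᵥ x) * (y ⬝ᵥ y)) (j : ι) :
    ∑ i, B i j ^ 2 ≤ κ := by
  have h := hB (fun i => B i j) (Pi.single j 1)
  have h1 : B.mulVec (Pi.single j 1) = fun i => B i j := by
    ext i; simp
  have h2 : (fun i => B i j) ⬝ᵥ (fun i => B i j) = ∑ i, B i j ^ 2 := by
    simp [dotProduct, sq]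
  rw [h1, h2] at h
  simp only [single_dotProduct, Pi.single_eq_same, mul_one] at h
  have h0 : 0 ≤ ∑ i, B i j ^ 2 := Finset.sum_nonneg fun _ _ => sq_nonneg _
  -- If S = 0 one cannot cancel it, but then only κ ≥ 0 is needed.
  rcases h0.eq_or_lt with h3 | h3
  · have h5 := hB (Pi.single j 1) (Pi.single j 1)
    rw [h1] at h5
    simp only [single_dotProduct, Pi.single_eq_same, mul_one] at h5
    rw [← h3]; nlinarith [sq_nonneg (B j j)]
  · nlinarith

theorem sq_diag_le {ι : Type*} [Fintype ι] [DecidableEq ι] {B : Matrix ι ι ℝ} {κ : ℝ}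
    (hB : ∀ x y : ι → ℝ, (x ⬝ᵥ B.mulVec y) ^ 2 ≤ κ * (x ⬝ᵥ x) * (y ⬝ᵥ y)) (j : ι) :
    B j j ^ 2 ≤ κ :=
  (Finset.single_le_sum (f := fun i => B i j ^ 2) (fun _ _ => sq_nonneg _)
    (Finset.mem_univ j)).trans (sum_sq_col_le hB j)

/-- The fourth moment bounds in fixed dimension `n`, with constant `C`. -/
structure FourthMomentBounds {n : ℕ} (μ : Measure (Fin n → ℝ)) (C : ℝ) : Prop where
  integrable : ∀ j, Integrable (fun y : Fin n → ℝ => y j ^ 4) μ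
  a22_sub : ∀ i j : Fin n, i ≠ j → |a22 μ i j - ((n : ℝ) ^ 2)⁻¹| ≤ C * ((n : ℝ) ^ 3)⁻¹
  kappa4 : ∀ i j : Fin n, i ≠ j → |kappa4 μ i j| ≤ C * ((n : ℝ) ^ 2)⁻¹

section OneVector

variable {n : ℕ} {μ : Measure (Fin n → ℝ)} {C : ℝ}

theorem FourthMomentBounds.a22_le (h : FourthMomentBounds μ C) (hC : 0 ≤ C) (hn : 2 ≤ n)
    {i j : Fin n} (hij : i ≠ j) : |a22 μ i j| ≤ (1 + C) * ((n : ℝ) ^ 2)⁻¹ := by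
  have h1 := h.a22_sub i j hij
  have hn' : (2 : ℝ) ≤ n := by exact_mod_cast hn
  have h2 : ((n : ℝ) ^ 3)⁻¹ ≤ ((n : ℝ) ^ 2)⁻¹ := by
    apply inv_anti₀ (by positivity)
    exact pow_le_pow_right₀ (by linarith) (by norm_num)
  have h3 : 0 ≤ ((n : ℝ) ^ 2)⁻¹ := by positivity
  rw [abs_le] at h1 ⊢
  constructor <;> nlinarith

theorem FourthMomentBounds.fourth_le (h : FourthMomentBounds μ C) (hC : 0 ≤ C) (hn : 2 ≤ n)
    (j : Fin n) : |∫ y, y j ^ 4 ∂μ| ≤ (4 * C + 3) * ((n : ℝ) ^ 2)⁻¹ := by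
  -- κ₄ is defined through two distinct coordinates, so the bound on E y_j⁴ needs a second one.
  have : Nontrivial (Fin n) := Fin.nontrivial_iff_two_le.mpr hn
  obtain ⟨i, hi⟩ := exists_ne j
  have h1 := h.kappa4 i j hi
  have h2 := h.a22_le hC hn hi
  rw [_root_.kappa4] at h1
  rw [abs_le] at *
  constructor <;> linarith

/-- After expanding, only the pairings (k, l) = (i, j) and (j, i) survive. Each carries a₂₂ =
O(n⁻²), while the squared Hilbert–Schmidt norm of B is at most nκ, so the total is O(κ/n). -/
theorem integral_offDiag_sq_le [IsProbabilityMeasure μ] (hunc : IsUnconditional μ)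
    (h : FourthMomentBounds μ C) (hC : 0 ≤ C) (hn : 2 ≤ n) {B : Matrix (Fin n) (Fin n) ℝ} {κ : ℝ}
    (hB : ∀ x y, (x ⬝ᵥ B.mulVec y) ^ 2 ≤ κ * (x ⬝ᵥ x) * (y ⬝ᵥ y)) :
    Integrable (fun y : Fin n → ℝ =>
        (∑ i, ∑ j, (if i = j then 0 else B i j) * (y i * y j)) ^ 2) μ ∧
      ∫ y, (∑ i, ∑ j, (if i = j then 0 else B i j) * (y i * y j)) ^ 2 ∂μ ≤
        (2 + 2 * C) * κ / n := by
  set o : Fin n → Fin n → ℝ := fun i j => if i = j then 0 else B i j with ho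
  have hn' : (2 : ℝ) ≤ n := by exact_mod_cast hn
  have hexp : (fun y : Fin n → ℝ => (∑ i, ∑ j, o i j * (y i * y j)) ^ 2) =
      fun y => ∑ i, ∑ j, ∑ k, ∑ l, o i j * o k l * (y i * y j * (y k * y l)) := by
    ext y
    rw [sq, Finset.sum_mul]
    refine Finset.sum_congr rfl fun i _ => ?_
    rw [Finset.sum_mul]
    refine Finset.sum_congr rfl fun j _ => ?_
    rw [Finset.mul_sum]
    refine Finset.sum_congr rfl fun k _ => ?_
    rw [Finset.mul_sum]
    refine Finset.sum_congr rfl fun l _ => ?_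
    ring
  have hint : ∀ i j k l, Integrable
      (fun y : Fin n → ℝ => o i j * o k l * (y i * y j * (y k * y l))) μ :=
    fun i j k l => (integrable_quartic_monomial h.integrable i j k l).const_mul _
  refine ⟨?_, ?_⟩
  · rw [hexp]
    exact integrable_finsetSum _ fun i _ => integrable_finsetSum _ fun j _ =>
      integrable_finsetSum _ fun k _ => integrable_finsetSum _ fun l _ => hint i j k l
  rw [hexp, integral_finsetSum _ fun i _ => integrable_finsetSum _ fun j _ =>
      integrable_finsetSum _ fun k _ => integrable_finsetSum _ fun l _ => hint i j k l]
  have hterm : ∀ i j, ∫ y, ∑ k, ∑ l, o i j * o k l * (y i * y j * (y k * y l)) ∂μ =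
      o i j * (o i j + o j i) * a22 μ i j := by
    intro i j
    rw [integral_finsetSum _ fun k _ => integrable_finsetSum _ fun l _ => hint i j k l]
    by_cases hij : i = j
    · have : o i j = 0 := by simp [ho, hij]
      simp [this]
    have h1 : ∀ k l, ∫ y, o i j * o k l * (y i * y j * (y k * y l)) ∂μ =
        (if k = i ∧ l = j then o i j * o i j * a22 μ i j else 0) +
        (if k = j ∧ l = i then o i j * o j i * a22 μ i j else 0) := by
      intro k l
      rw [integral_const_mul]
      by_cases hkl : k = l
      · have : o k l = 0 := by simp [ho, hkl]
        have h1 : ¬ (k = i ∧ l = j) := by grind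
        have h2 : ¬ (k = j ∧ l = i) := by grind
        simp [this, h1, h2]
      · rw [integral_quartic_monomial_eq hunc hij]
        by_cases h1 : k = i ∧ l = j
        · have h2 : ¬ (k = j ∧ l = i) := by grind
          obtain ⟨rfl, rfl⟩ := h1
          simp [h2]
        · by_cases h2 : k = j ∧ l = i
          · rw [if_neg h1, if_pos (Or.inr h2), if_pos h2, h2.1, h2.2, zero_add]
          · simp [h1, h2]
    have h2 : ∀ k, ∫ y, ∑ l, o i j * o k l * (y i * y j * (y k * y l)) ∂μ =
        ∑ l, ((if k = i ∧ l = j then o i j * o i j * a22 μ i j else 0) +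
        (if k = j ∧ l = i then o i j * o j i * a22 μ i j else 0)) := by
      intro k
      rw [integral_finsetSum _ fun l _ => hint i j k l]
      exact Finset.sum_congr rfl fun l _ => h1 k l
    simp only [h2, Finset.sum_add_distrib, ite_and, Finset.sum_ite_eq', Finset.mem_univ, if_true,
      Finset.sum_ite_irrel, Finset.sum_const_zero]
    ring
  have hsum : ∀ i, ∫ y, ∑ j, ∑ k, ∑ l, o i j * o k l * (y i * y j * (y k * y l)) ∂μ =
      ∑ j, o i j * (o i j + o j i) * a22 μ i j := by
    intro i
    rw [integral_finsetSum _ fun j _ =>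
      integrable_finsetSum _ fun k _ => integrable_finsetSum _ fun l _ => hint i j k l]
    exact Finset.sum_congr rfl fun j _ => hterm i j
  rw [Finset.sum_congr rfl fun i _ => hsum i]
  have hbd : ∀ i j, o i j * (o i j + o j i) * a22 μ i j ≤
      (3 / 2 * B i j ^ 2 + 1 / 2 * B j i ^ 2) * ((1 + C) * ((n : ℝ) ^ 2)⁻¹) := by
    intro i j
    by_cases hij : i = j
    · have : o i j = 0 := by simp [ho, hij]
      rw [this, zero_mul, zero_mul]
      positivity
    have ha := h.a22_le hC hn hij
    have e1 : o i j = B i j := by simp [ho, hij]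
    have e2 : o j i = B j i := by simp [ho, Ne.symm hij]
    rw [e1, e2]
    calc _ ≤ |B i j * (B i j + B j i) * a22 μ i j| := le_abs_self _
      _ = |B i j * (B i j + B j i)| * |a22 μ i j| := abs_mul _ _
      _ ≤ _ := by
        refine mul_le_mul ?_ ha (abs_nonneg _) (by positivity)
        rw [abs_le]
        constructor <;> nlinarith [sq_nonneg (B i j + B j i), sq_nonneg (B i j - B j i)]
  have hcol : ∑ i, ∑ j, B i j ^ 2 ≤ n * κ := by
    rw [Finset.sum_comm]
    calc _ ≤ ∑ _j : Fin n, κ := Finset.sum_le_sum fun j _ => sum_sq_col_le hB j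
      _ = n * κ := by simp
  have hcol' : ∑ i, ∑ j, B j i ^ 2 ≤ n * κ := by rw [Finset.sum_comm]; exact hcol
  calc _ ≤ ∑ i, ∑ j, (3 / 2 * B i j ^ 2 + 1 / 2 * B j i ^ 2) * ((1 + C) * ((n : ℝ) ^ 2)⁻¹) :=
        Finset.sum_le_sum fun i _ => Finset.sum_le_sum fun j _ => hbd i j
    _ = (3 / 2 * ∑ i, ∑ j, B i j ^ 2 + 1 / 2 * ∑ i, ∑ j, B j i ^ 2) *
          ((1 + C) * ((n : ℝ) ^ 2)⁻¹) := by
        simp only [← Finset.sum_mul, Finset.sum_add_distrib, Finset.mul_sum]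
    _ ≤ (2 * (n * κ)) * ((1 + C) * ((n : ℝ) ^ 2)⁻¹) := by
        gcongr
        linarith
    _ = _ := by field_simp

/-- The expansion consists of covariances of the y_i². The n² off-diagonal ones are O(n⁻³), which is
where the sharp asymptotics of a₂₂ enter; the n diagonal ones are O(n⁻²). Both groups contribute
O(κ/n). -/
theorem integral_diag_sq_le [IsProbabilityMeasure μ] (hiso : IsNormalizedIsotropic μ)
    (h : FourthMomentBounds μ C) (hC : 0 ≤ C) (hn : 2 ≤ n) {B : Matrix (Fin n) (Fin n) ℝ} {κ : ℝ}
    (hB : ∀ x y, (x ⬝ᵥ B.mulVec y) ^ 2 ≤ κ * (x ⬝ᵥ x) * (y ⬝ᵥ y)) :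
    Integrable (fun y : Fin n → ℝ => (∑ i, B i i * (y i ^ 2 - (n : ℝ)⁻¹)) ^ 2) μ ∧
      ∫ y, (∑ i, B i i * (y i ^ 2 - (n : ℝ)⁻¹)) ^ 2 ∂μ ≤ (5 * C + 4) * κ / n := by
  have hn' : (2 : ℝ) ≤ n := by exact_mod_cast hn
  have hexp : (fun y : Fin n → ℝ => (∑ i, B i i * (y i ^ 2 - (n : ℝ)⁻¹)) ^ 2) =
      fun y => ∑ i, ∑ j, B i i * B j j * (y i * y i * (y j * y j) - (n : ℝ)⁻¹ * (y i * y i)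
        - (n : ℝ)⁻¹ * (y j * y j) + (n : ℝ)⁻¹ ^ 2) := by
    ext y
    rw [sq, Finset.sum_mul]
    refine Finset.sum_congr rfl fun i _ => ?_
    rw [Finset.mul_sum]
    refine Finset.sum_congr rfl fun j _ => ?_
    ring
  have h2int : ∀ i, Integrable (fun y : Fin n → ℝ => y i * y i) μ := fun i => by
    simpa [sq] using (hiso.memLp i).integrable_sq
  have h4int := fun i j => integrable_quartic_monomial h.integrable i i j j
  have hint : ∀ i j, Integrable (fun y : Fin n → ℝ => B i i * B j j *
      (y i * y i * (y j * y j) - (n : ℝ)⁻¹ * (y i * y i)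
        - (n : ℝ)⁻¹ * (y j * y j) + (n : ℝ)⁻¹ ^ 2)) μ := fun i j =>
    ((((h4int i j).sub ((h2int i).const_mul _)).sub ((h2int j).const_mul _)).add
      (integrable_const _)).const_mul _
  refine ⟨?_, ?_⟩
  · rw [hexp]
    exact integrable_finsetSum _ fun i _ => integrable_finsetSum _ fun j _ => hint i j
  rw [hexp, integral_finsetSum _ fun i _ => integrable_finsetSum _ fun j _ => hint i j]
  have h2 : ∀ i, ∫ y, y i * y i ∂μ = (n : ℝ)⁻¹ := fun i => by simpa using hiso.cov i i
  have hterm : ∀ i j, ∫ y, B i i * B j j * (y i * y i * (y j * y j) - (n : ℝ)⁻¹ * (y i * y i)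
        - (n : ℝ)⁻¹ * (y j * y j) + (n : ℝ)⁻¹ ^ 2) ∂μ =
      B i i * B j j * (∫ y, y i * y i * (y j * y j) ∂μ - ((n : ℝ) ^ 2)⁻¹) := by
    intro i j
    rw [integral_const_mul, integral_add, integral_sub, integral_sub, integral_const_mul,
      integral_const_mul, h2, h2]
    · rw [integral_const, probReal_univ, one_smul]; ring
    · exact h4int i j
    · exact (h2int i).const_mul _
    · exact (h4int i j).sub ((h2int i).const_mul _)
    · exact (h2int j).const_mul _
    · exact ((h4int i j).sub ((h2int i).const_mul _)).sub ((h2int j).const_mul _)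
    · exact integrable_const _
  have hκ : 0 ≤ κ := (sq_nonneg _).trans (sq_diag_le hB ⟨0, by omega⟩)
  have hBB : ∀ i j, |B i i * B j j| ≤ κ := by
    intro i j
    have h1 := sq_diag_le hB i
    have h2 := sq_diag_le hB j
    rw [abs_le]
    constructor <;> nlinarith [sq_nonneg (B i i + B j j), sq_nonneg (B i i - B j j)]
  have hbd : ∀ i j, B i i * B j j * (∫ y, y i * y i * (y j * y j) ∂μ - ((n : ℝ) ^ 2)⁻¹) ≤
      κ * (C * ((n : ℝ) ^ 3)⁻¹) + if i = j then κ * ((4 * C + 4) * ((n : ℝ) ^ 2)⁻¹) else 0 := by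
    intro i j
    refine (le_abs_self _).trans ?_
    rw [abs_mul]
    by_cases hij : i = j
    · subst hij
      have h4 := h.fourth_le hC hn i
      have e : ∫ y, y i * y i * (y i * y i) ∂μ = ∫ y, y i ^ 4 ∂μ := by
        congr 1; ext y; ring
      rw [e, if_pos rfl]
      have h5 : |∫ y, y i ^ 4 ∂μ - ((n : ℝ) ^ 2)⁻¹| ≤ (4 * C + 4) * ((n : ℝ) ^ 2)⁻¹ := by
        have : 0 ≤ ((n : ℝ) ^ 2)⁻¹ := by positivity
        rw [abs_le] at *
        constructor <;> linarith
      have h6 : 0 ≤ κ * (C * ((n : ℝ) ^ 3)⁻¹) := by positivity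
      have := mul_le_mul (hBB i i) h5 (abs_nonneg _) hκ
      linarith
    · have e : ∫ y, y i * y i * (y j * y j) ∂μ = a22 μ i j := by
        unfold a22; congr 1; ext y; ring
      rw [e, if_neg hij, add_zero]
      exact mul_le_mul (hBB i j) (h.a22_sub i j hij) (abs_nonneg _) hκ
  calc _ = ∑ i, ∑ j, B i i * B j j * (∫ y, y i * y i * (y j * y j) ∂μ - ((n : ℝ) ^ 2)⁻¹) := by
        refine Finset.sum_congr rfl fun i _ => ?_
        rw [integral_finsetSum _ fun j _ => hint i j]
        exact Finset.sum_congr rfl fun j _ => hterm i j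
    _ ≤ ∑ i : Fin n, ∑ j, (κ * (C * ((n : ℝ) ^ 3)⁻¹) +
          if i = j then κ * ((4 * C + 4) * ((n : ℝ) ^ 2)⁻¹) else 0) :=
        Finset.sum_le_sum fun i _ => Finset.sum_le_sum fun j _ => hbd i j
    _ = _ := by
        simp only [Finset.sum_add_distrib, Finset.sum_ite_eq, Finset.mem_univ, if_true,
          Finset.sum_const, Finset.card_univ, Fintype.card_fin, nsmul_eq_mul]
        field_simp
        ring

/-- Concentration of quadratic forms of an isotropic unconditional vector. -/
theorem lintegral_quadForm_sub_le [IsProbabilityMeasure μ] (hiso : IsNormalizedIsotropic μ)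
    (hunc : IsUnconditional μ) (h : FourthMomentBounds μ C) (hC : 0 ≤ C) (hn : 2 ≤ n)
    {B : Matrix (Fin n) (Fin n) ℝ} {κ : ℝ}
    (hB : ∀ x y, (x ⬝ᵥ B.mulVec y) ^ 2 ≤ κ * (x ⬝ᵥ x) * (y ⬝ᵥ y)) :
    ∫⁻ y, ENNReal.ofReal ((y ⬝ᵥ B.mulVec y - B.trace / n) ^ 2) ∂μ ≤
      ENNReal.ofReal ((14 * C + 12) * κ / n) := by
  obtain ⟨i1, b1⟩ := integral_offDiag_sq_le hunc h hC hn hB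
  obtain ⟨i2, b2⟩ := integral_diag_sq_le hiso h hC hn hB
  have hsplit : ∀ y : Fin n → ℝ, y ⬝ᵥ B.mulVec y - B.trace / n =
      (∑ i, ∑ j, (if i = j then 0 else B i j) * (y i * y j)) +
        ∑ i, B i i * (y i ^ 2 - (n : ℝ)⁻¹) := by
    intro y
    have h1 : ∀ i, ∑ j, (if i = j then 0 else B i j) * (y i * y j) =
        ∑ j, B i j * (y i * y j) - B i i * (y i * y i) := by
      intro i
      rw [eq_sub_iff_add_eq]
      have : B i i * (y i * y i) = ∑ j, if i = j then B i j * (y i * y j) else 0 := by simp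
      rw [this, ← Finset.sum_add_distrib]
      refine Finset.sum_congr rfl fun j _ => ?_
      split_ifs <;> ring
    simp only [h1, dotProduct, Matrix.mulVec, Matrix.trace, Matrix.diag, Finset.sum_div,
      ← Finset.sum_sub_distrib, ← Finset.sum_add_distrib]
    refine Finset.sum_congr rfl fun i _ => ?_
    rw [Finset.mul_sum, Finset.sum_congr rfl fun j _ =>
      (by ring : y i * (B i j * y j) = B i j * (y i * y j))]
    ring
  calc _ ≤ ∫⁻ y, ENNReal.ofReal
        (2 * (∑ i, ∑ j, (if i = j then 0 else B i j) * (y i * y j)) ^ 2 +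
          2 * (∑ i, B i i * (y i ^ 2 - (n : ℝ)⁻¹)) ^ 2) ∂μ := by
        refine lintegral_mono fun y => ENNReal.ofReal_le_ofReal ?_
        rw [hsplit y]
        nlinarith [sq_nonneg ((∑ i, ∑ j, (if i = j then 0 else B i j) * (y i * y j)) -
          ∑ i, B i i * (y i ^ 2 - (n : ℝ)⁻¹))]
    _ = ENNReal.ofReal (∫ y, (2 * (∑ i, ∑ j, (if i = j then 0 else B i j) * (y i * y j)) ^ 2 +
          2 * (∑ i, B i i * (y i ^ 2 - (n : ℝ)⁻¹)) ^ 2) ∂μ) :=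
        (ofReal_integral_eq_lintegral_ofReal ((i1.const_mul 2).add (i2.const_mul 2))
          (ae_of_all _ fun y => add_nonneg (mul_nonneg zero_le_two (sq_nonneg _))
            (mul_nonneg zero_le_two (sq_nonneg _)))).symm
    _ ≤ _ := by
        apply ENNReal.ofReal_le_ofReal
        rw [integral_add (i1.const_mul 2) (i2.const_mul 2), integral_const_mul, integral_const_mul]
        have : (14 * C + 12) * κ / n = 2 * ((2 + 2 * C) * κ / n) + 2 * ((5 * C + 4) * κ / n) := by
          ring
        linarith

end OneVector

/-! ### Quadratic forms of tensor products, by splitting off one factor -/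

theorem sum_fin_succ_pi {k n : ℕ} {M : Type*} [AddCommMonoid M] (f : (Fin (k + 1) → Fin n) → M) :
    ∑ I, f I = ∑ a : Fin n, ∑ I : Fin k → Fin n, f (Fin.cons a I) := by
  rw [← Fintype.sum_prod_type', ← (Fin.consEquiv fun _ : Fin (k + 1) => Fin n).sum_comp]
  rfl

theorem measurePreserving_finCons {X : Type*} [MeasurableSpace X] (μ : Measure X)
    [IsProbabilityMeasure μ] (k : ℕ) :
    MeasurePreserving (fun z : X × (Fin k → X) => (Fin.cons z.1 z.2 : Fin (k + 1) → X))
      (μ.prod (Measure.pi fun _ : Fin k => μ)) (Measure.pi fun _ : Fin (k + 1) => μ) := by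
  convert (measurePreserving_piFinSuccAbove (fun _ : Fin (k + 1) => μ) 0).symm using 1
  ext z : 1
  simp [MeasurableEquiv.piFinSuccAbove, Fin.insertNthEquiv]

theorem lintegral_pi_succ {X : Type*} [MeasurableSpace X] (μ : Measure X)
    [IsProbabilityMeasure μ] {k : ℕ} {F : (Fin (k + 1) → X) → ENNReal} (hF : Measurable F) :
    ∫⁻ Y, F Y ∂(Measure.pi fun _ : Fin (k + 1) => μ) =
      ∫⁻ Y, ∫⁻ y, F (Fin.cons y Y) ∂μ ∂(Measure.pi fun _ : Fin k => μ) := by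
  have hmp := measurePreserving_finCons μ k
  rw [← hmp.lintegral_comp hF]
  exact lintegral_prod_symm' _ (hF.comp hmp.measurable)

/-- The tensor product of a vector with a tensor, as a tensor of one order more. -/
def consTensor {k n : ℕ} (x : Fin n → ℝ) (X : (Fin k → Fin n) → ℝ) : (Fin (k + 1) → Fin n) → ℝ :=
  fun I => x (I 0) * X (Fin.tail I)

/-- The quadratic form of `H` at `x ⊗ X`, as a quadratic form in `x`. -/
def sliceForm {k n : ℕ} (H : Matrix (Fin (k + 1) → Fin n) (Fin (k + 1) → Fin n) ℝ)
    (X : (Fin k → Fin n) → ℝ) : Matrix (Fin n) (Fin n) ℝ :=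
  Matrix.of fun a b => ∑ I, ∑ J, X I * (H (Fin.cons a I) (Fin.cons b J) * X J)

/-- The normalized partial trace over the first tensor factor. -/
noncomputable def partialTrace {k n : ℕ} (H : Matrix (Fin (k + 1) → Fin n) (Fin (k + 1) → Fin n) ℝ) :
    Matrix (Fin k → Fin n) (Fin k → Fin n) ℝ :=
  Matrix.of fun I J => (∑ a, H (Fin.cons a I) (Fin.cons a J)) / n

section

variable {k n : ℕ} (H : Matrix (Fin (k + 1) → Fin n) (Fin (k + 1) → Fin n) ℝ)

theorem tensorVec_cons (y : Fin n → ℝ) (Y : Fin k → Fin n → ℝ) :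
    tensorVec (Fin.cons y Y : Fin (k + 1) → Fin n → ℝ) = consTensor y (tensorVec Y) := by
  ext I
  simp [tensorVec, consTensor, Fin.prod_univ_succ, Fin.tail]

theorem consTensor_dotProduct_mulVec (x z : Fin n → ℝ) (X Z : (Fin k → Fin n) → ℝ) :
    consTensor x X ⬝ᵥ H.mulVec (consTensor z Z) =
      ∑ a, ∑ b, x a * ((∑ I, ∑ J, X I * (H (Fin.cons a I) (Fin.cons b J) * Z J)) * z b) := by
  simp only [dotProduct, Matrix.mulVec, sum_fin_succ_pi, consTensor, Fin.cons_zero, Fin.tail_cons]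
  refine Finset.sum_congr rfl fun a _ => ?_
  simp only [Finset.mul_sum, Finset.sum_mul]
  rw [Finset.sum_comm]
  refine Finset.sum_congr rfl fun b _ => ?_
  refine Finset.sum_congr rfl fun I _ => ?_
  refine Finset.sum_congr rfl fun J _ => ?_
  ring

theorem consTensor_dotProduct_mulVec_same (x z : Fin n → ℝ) (X : (Fin k → Fin n) → ℝ) :
    consTensor x X ⬝ᵥ H.mulVec (consTensor z X) = x ⬝ᵥ (sliceForm H X).mulVec z := by
  rw [consTensor_dotProduct_mulVec]
  simp only [dotProduct, Matrix.mulVec, sliceForm, Matrix.of_apply, Finset.mul_sum]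

theorem consTensor_dotProduct_self (x : Fin n → ℝ) (X : (Fin k → Fin n) → ℝ) :
    consTensor x X ⬝ᵥ consTensor x X = (x ⬝ᵥ x) * (X ⬝ᵥ X) := by
  simp only [dotProduct, sum_fin_succ_pi, consTensor, Fin.cons_zero, Fin.tail_cons,
    Finset.sum_mul_sum]
  refine Finset.sum_congr rfl fun a _ => Finset.sum_congr rfl fun I _ => by ring

theorem dotProduct_partialTrace_mulVec (X Z : (Fin k → Fin n) → ℝ) :
    X ⬝ᵥ (partialTrace H).mulVec Z =
      (∑ a, consTensor (Pi.single a 1) X ⬝ᵥ H.mulVec (consTensor (Pi.single a 1) Z)) / n := by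
  simp only [consTensor_dotProduct_mulVec, Pi.single_apply, ite_mul, mul_ite, one_mul, mul_one,
    zero_mul, mul_zero, Finset.sum_ite_eq', Finset.mem_univ, if_true]
  simp only [dotProduct, Matrix.mulVec, partialTrace, Matrix.of_apply, Finset.mul_sum,
    Finset.sum_div, Finset.sum_mul]
  conv_rhs => rw [Finset.sum_comm]
  refine Finset.sum_congr rfl fun I _ => ?_
  conv_rhs => rw [Finset.sum_comm]
  refine Finset.sum_congr rfl fun J _ => Finset.sum_congr rfl fun a _ => by ring

/-- By isotropy the left side is the mean of the form at y ⊗ X over y alone. It is again a quadratic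
form in X, with one factor fewer, which is what the induction on k needs. -/
theorem trace_sliceForm_div (X : (Fin k → Fin n) → ℝ) :
    (sliceForm H X).trace / n = X ⬝ᵥ (partialTrace H).mulVec X := by
  rw [dotProduct_partialTrace_mulVec]
  congr 1
  refine Finset.sum_congr rfl fun a _ => ?_
  rw [consTensor_dotProduct_mulVec_same]
  simp

theorem trace_partialTrace_div :
    (partialTrace H).trace / (n : ℝ) ^ k = H.trace / (n : ℝ) ^ (k + 1) := by
  simp only [Matrix.trace, Matrix.diag, sum_fin_succ_pi, partialTrace, Matrix.of_apply,
    ← Finset.sum_div]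
  rw [Finset.sum_comm, div_div, pow_succ']

variable {H} {κ : ℝ}


/-- The norm bound of the slice grows with X, so averaging over X later requires a bound for E‖X‖⁴.
-/
theorem sliceForm_bound
    (hH : ∀ x y, (x ⬝ᵥ H.mulVec y) ^ 2 ≤ κ * (x ⬝ᵥ x) * (y ⬝ᵥ y))
    (X : (Fin k → Fin n) → ℝ) (x y : Fin n → ℝ) :
    (x ⬝ᵥ (sliceForm H X).mulVec y) ^ 2 ≤ κ * (X ⬝ᵥ X) ^ 2 * (x ⬝ᵥ x) * (y ⬝ᵥ y) := by
  rw [← consTensor_dotProduct_mulVec_same]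
  refine (hH _ _).trans (le_of_eq ?_)
  rw [consTensor_dotProduct_self, consTensor_dotProduct_self]
  ring

/-- An average of n compressions of H has norm no larger than that of H. Keeping the same κ is what
lets the induction on the number of factors close. -/
theorem partialTrace_bound
    (hH : ∀ x y, (x ⬝ᵥ H.mulVec y) ^ 2 ≤ κ * (x ⬝ᵥ x) * (y ⬝ᵥ y))
    (hn : 0 < n) (X Z : (Fin k → Fin n) → ℝ) :
    (X ⬝ᵥ (partialTrace H).mulVec Z) ^ 2 ≤ κ * (X ⬝ᵥ X) * (Z ⬝ᵥ Z) := by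
  have hn' : (0 : ℝ) < n := by exact_mod_cast hn
  rw [dotProduct_partialTrace_mulVec, div_pow, div_le_iff₀ (by positivity)]
  refine sq_sum_le_card_mul_sum_sq.trans ?_
  have h1 : ∀ a : Fin n, (consTensor (Pi.single a 1) X ⬝ᵥ
      H.mulVec (consTensor (Pi.single a 1) Z)) ^ 2 ≤ κ * (X ⬝ᵥ X) * (Z ⬝ᵥ Z) := by
    intro a
    refine (hH _ _).trans (le_of_eq ?_)
    rw [consTensor_dotProduct_self, consTensor_dotProduct_self]
    simp
  calc _ ≤ ((Finset.univ : Finset (Fin n)).card : ℝ) *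
        ∑ _a : Fin n, κ * (X ⬝ᵥ X) * (Z ⬝ᵥ Z) := by
        gcongr with a
        exact h1 a
    _ = _ := by simp; ring

end

theorem one_mulVec_bound {ι : Type*} [Fintype ι] [DecidableEq ι] (x y : ι → ℝ) :
    (x ⬝ᵥ (1 : Matrix ι ι ℝ).mulVec y) ^ 2 ≤ 1 * (x ⬝ᵥ x) * (y ⬝ᵥ y) := by
  rw [Matrix.one_mulVec, one_mul]
  simpa [dotProduct, sq] using Finset.sum_mul_sq_le_sq_mul_sq Finset.univ x y

theorem measurable_tensorVec {k n : ℕ} :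
    Measurable (tensorVec : (Fin k → Fin n → ℝ) → (Fin k → Fin n) → ℝ) := by
  unfold tensorVec
  fun_prop

theorem measurable_dotProduct_mulVec {ι : Type*} [Fintype ι] (H : Matrix ι ι ℝ) :
    Measurable fun X : ι → ℝ => X ⬝ᵥ H.mulVec X := by
  simp only [dotProduct, Matrix.mulVec]
  fun_prop

/-- The constant in the concentration bound for quadratic forms of a `k`-fold tensor product. -/
noncomputable def tensorQuadConst (C : ℝ) : ℕ → ℝ
  | 0 => 0
  | k + 1 => 2 * (14 * C + 12) * (2 + 2 * tensorQuadConst C k) + 2 * tensorQuadConst C k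

theorem tensorQuadConst_nonneg {C : ℝ} (hC : 0 ≤ C) : ∀ k, 0 ≤ tensorQuadConst C k
  | 0 => le_rfl
  | k + 1 => by
    have := tensorQuadConst_nonneg hC k
    unfold tensorQuadConst
    positivity

/-- Concentration of quadratic forms of tensor products of independent vectors. -/
theorem lintegral_tensor_quadForm_sub_le {n : ℕ} {μ : Measure (Fin n → ℝ)} {C : ℝ}
    [IsProbabilityMeasure μ] (hiso : IsNormalizedIsotropic μ)
    (hunc : IsUnconditional μ) (h : FourthMomentBounds μ C) (hC : 0 ≤ C) (hn : 2 ≤ n) (k : ℕ) :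
    ∀ {H : Matrix (Fin k → Fin n) (Fin k → Fin n) ℝ} {κ : ℝ},
    (∀ x y, (x ⬝ᵥ H.mulVec y) ^ 2 ≤ κ * (x ⬝ᵥ x) * (y ⬝ᵥ y)) →
    ∫⁻ Y, ENNReal.ofReal ((tensorVec Y ⬝ᵥ H.mulVec (tensorVec Y) - H.trace / (n : ℝ) ^ k) ^ 2)
        ∂(Measure.pi fun _ : Fin k => μ) ≤
      ENNReal.ofReal (tensorQuadConst C k * κ / n) := by
  have hn' : (2 : ℝ) ≤ n := by exact_mod_cast hn
  induction k with
  | zero =>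
    intro H κ hH
    -- The empty tensor product is the scalar 1, so there is no deviation at all.
    have : ∀ Y : Fin 0 → Fin n → ℝ, (tensorVec Y ⬝ᵥ H.mulVec (tensorVec Y) -
        H.trace / (n : ℝ) ^ 0) = 0 := by
      intro Y
      simp [dotProduct, Matrix.mulVec, tensorVec, Matrix.trace]
    simp only [this]
    simp
  | succ k ih =>
    intro H κ hH
    have hκ : 0 ≤ κ := (sq_nonneg _).trans (sq_diag_le hH fun _ => ⟨0, by omega⟩)
    have hD := tensorQuadConst_nonneg hC k
    set ρ := Measure.pi fun _ : Fin k => μ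
    have hF : Measurable fun Y : Fin (k + 1) → Fin n → ℝ => ENNReal.ofReal
        ((tensorVec Y ⬝ᵥ H.mulVec (tensorVec Y) - H.trace / (n : ℝ) ^ (k + 1)) ^ 2) :=
      ((((measurable_dotProduct_mulVec H).comp measurable_tensorVec).sub_const _).pow_const
        2).ennreal_ofReal
    rw [lintegral_pi_succ μ hF]
    simp only [tensorVec_cons, consTensor_dotProduct_mulVec_same]
    -- The induction hypothesis for the identity matrix controls E(‖X‖² - 1)², and x² ≤ 2 + 2(x -
    -- 1)² turns this into a bound for E‖X‖⁴.
    have hfourth : ∫⁻ Y, ENNReal.ofReal ((tensorVec Y ⬝ᵥ tensorVec Y) ^ 2) ∂ρ ≤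
        ENNReal.ofReal (2 + 2 * tensorQuadConst C k) := by
      have h1 := ih (H := 1) (κ := 1) one_mulVec_bound
      have htr : (1 : Matrix (Fin k → Fin n) (Fin k → Fin n) ℝ).trace / (n : ℝ) ^ k = 1 := by
        have : (n : ℝ) ≠ 0 := by linarith
        simp [Matrix.trace_one, this]
      rw [htr] at h1
      simp only [Matrix.one_mulVec] at h1
      calc _ ≤ ∫⁻ Y, (2 + 2 * ENNReal.ofReal ((tensorVec Y ⬝ᵥ tensorVec Y - 1) ^ 2)) ∂ρ := by
            refine lintegral_mono fun Y => ?_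
            have e : (2 + 2 * ENNReal.ofReal ((tensorVec Y ⬝ᵥ tensorVec Y - 1) ^ 2)) =
                ENNReal.ofReal (2 + 2 * (tensorVec Y ⬝ᵥ tensorVec Y - 1) ^ 2) := by
              rw [ENNReal.ofReal_add (by positivity) (by positivity),
                ENNReal.ofReal_mul (by positivity)]
              simp
            rw [e]
            apply ENNReal.ofReal_le_ofReal
            nlinarith [sq_nonneg (tensorVec Y ⬝ᵥ tensorVec Y - 2)]
        _ ≤ 2 + 2 * ENNReal.ofReal (tensorQuadConst C k * 1 / n) := by
            rw [lintegral_add_left measurable_const, lintegral_const_mul' _ _ (by simp)]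
            simp only [lintegral_const, measure_univ, mul_one]
            gcongr
            simpa using h1
        _ ≤ 2 + 2 * ENNReal.ofReal (tensorQuadConst C k) := by
            gcongr
            rw [mul_one]
            exact div_le_self hD (by linarith)
        _ = _ := by
            rw [ENNReal.ofReal_add (by positivity) (by positivity),
                ENNReal.ofReal_mul (by positivity)]
            simp
    -- Split the deviation at the conditional mean given all factors but the first: the fluctuation
    -- in the first factor is governed by the one-vector bound, the fluctuation of the conditional
    -- mean by the induction hypothesis.
    calc _ ≤ ∫⁻ Y, (ENNReal.ofReal (2 * ((14 * C + 12) * κ / n)) *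
            ENNReal.ofReal ((tensorVec Y ⬝ᵥ tensorVec Y) ^ 2) +
          2 * ENNReal.ofReal ((tensorVec Y ⬝ᵥ (partialTrace H).mulVec (tensorVec Y) -
            (partialTrace H).trace / (n : ℝ) ^ k) ^ 2)) ∂ρ := by
          refine lintegral_mono fun Y => ?_
          dsimp only
          have h1 := lintegral_quadForm_sub_le hiso hunc h hC hn (sliceForm_bound hH (tensorVec Y))
          rw [trace_sliceForm_div] at h1
          set b := tensorVec Y ⬝ᵥ (partialTrace H).mulVec (tensorVec Y) -
            (partialTrace H).trace / (n : ℝ) ^ k with hb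
          calc _ ≤ ∫⁻ y, (2 * ENNReal.ofReal ((y ⬝ᵥ (sliceForm H (tensorVec Y)).mulVec y -
                tensorVec Y ⬝ᵥ (partialTrace H).mulVec (tensorVec Y)) ^ 2) +
                2 * ENNReal.ofReal (b ^ 2)) ∂μ := by
                refine lintegral_mono fun y => ?_
                set q := y ⬝ᵥ (sliceForm H (tensorVec Y)).mulVec y
                have e : 2 * ENNReal.ofReal
                    ((q - tensorVec Y ⬝ᵥ (partialTrace H).mulVec (tensorVec Y)) ^ 2) +
                    2 * ENNReal.ofReal (b ^ 2) = ENNReal.ofReal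
                    (2 * (q - tensorVec Y ⬝ᵥ (partialTrace H).mulVec (tensorVec Y)) ^ 2
                      + 2 * b ^ 2) := by
                  rw [ENNReal.ofReal_add (by positivity) (by positivity),
                    ENNReal.ofReal_mul (by positivity), ENNReal.ofReal_mul (by positivity)]
                  simp
                rw [e]
                apply ENNReal.ofReal_le_ofReal
                rw [← trace_partialTrace_div]
                have : q - (partialTrace H).trace / (n : ℝ) ^ k =
                    (q - tensorVec Y ⬝ᵥ (partialTrace H).mulVec (tensorVec Y)) + b := by
                  rw [hb]; ring
                rw [this]
                nlinarith [sq_nonneg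
                  (q - tensorVec Y ⬝ᵥ (partialTrace H).mulVec (tensorVec Y) - b)]
            _ ≤ _ := by
                rw [lintegral_add_right _ measurable_const, lintegral_const_mul' _ _ (by simp)]
                simp only [lintegral_const, measure_univ, mul_one]
                refine add_le_add ?_ le_rfl
                refine (mul_le_mul_right h1 2).trans (le_of_eq ?_)
                rw [← ENNReal.ofReal_mul (by positivity), ← ENNReal.ofReal_ofNat 2,
                  ← ENNReal.ofReal_mul (by positivity)]
                congr 1
                ring
      _ ≤ ENNReal.ofReal (2 * ((14 * C + 12) * κ / n)) *
            ENNReal.ofReal (2 + 2 * tensorQuadConst C k) +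
          2 * ENNReal.ofReal (tensorQuadConst C k * κ / n) := by
          have hm1 : Measurable fun Y : Fin k → Fin n → ℝ =>
              ENNReal.ofReal (2 * ((14 * C + 12) * κ / n)) *
              ENNReal.ofReal ((tensorVec Y ⬝ᵥ tensorVec Y) ^ 2) := by
            have := (measurable_dotProduct_mulVec (1 : Matrix (Fin k → Fin n) _ ℝ)).comp
              measurable_tensorVec
            simp only [Matrix.one_mulVec] at this
            exact (this.pow_const 2).ennreal_ofReal.const_mul _
          rw [lintegral_add_left hm1, lintegral_const_mul' _ _ ENNReal.ofReal_ne_top,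
            lintegral_const_mul' _ _ (by simp)]
          gcongr
          exact ih (partialTrace_bound hH (by omega))
      _ = _ := by
          rw [← ENNReal.ofReal_mul (by positivity), ← ENNReal.ofReal_ofNat 2,
            ← ENNReal.ofReal_mul (by positivity), ← ENNReal.ofReal_add (by positivity)
              (by positivity)]
          congr 1
          rw [tensorQuadConst]
          ring

/-! ### Differentiating the trace of an exponential -/

/-- A trace-like functional of the exponential is differentiable, with the commutative formula for
its derivative. -/
theorem hasFDerivAt_tracial_exp {𝔸 : Type*} [NormedRing 𝔸] [NormedAlgebra ℂ 𝔸] [CompleteSpace 𝔸]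
    (φ : 𝔸 →L[ℂ] ℂ) (hφ : ∀ a b, φ (a * b) = φ (b * a)) (x : 𝔸) :
    HasFDerivAt (fun x : 𝔸 => φ (NormedSpace.exp x))
      (φ.comp (ContinuousLinearMap.mul ℂ 𝔸 (NormedSpace.exp x))) x := by
  set g : ℕ → 𝔸 → ℂ := fun p x => ((p.factorial : ℂ)⁻¹) * φ (x ^ p) with hg
  set L : 𝔸 → 𝔸 →L[ℂ] ℂ := fun a => φ.comp (ContinuousLinearMap.mul ℂ 𝔸 a) with hL
  set g' : ℕ → 𝔸 → 𝔸 →L[ℂ] ℂ := fun p x =>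
    ((p.factorial : ℂ)⁻¹ * p) • L (x ^ (p - 1)) with hg'
  have hsum : ∀ x : 𝔸, HasSum (fun p : ℕ => ((p.factorial : ℂ)⁻¹) • x ^ p) (NormedSpace.exp x) :=
    fun x => by
      rw [NormedSpace.exp_eq_tsum ℂ]
      exact (NormedSpace.expSeries_summable' x).hasSum
  have hexp : (fun x : 𝔸 => φ (NormedSpace.exp x)) = fun x => ∑' p, g p x := by
    ext x
    rw [← ((hsum x).mapL φ).tsum_eq]
    simp [hg]
  have hder : ∀ p x, HasFDerivAt (g p) (g' p x) x := by
    intro p x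
    have h1 := (φ.hasFDerivAt.comp x (hasFDerivAt_pow' (𝕜 := ℂ) p (x := x))).const_mul
      ((p.factorial : ℂ)⁻¹)
    refine h1.congr_fderiv ?_
    ext h
    simp only [hg', hL, ContinuousLinearMap.comp_apply, smul_apply,
      sum_apply, map_sum, ContinuousLinearMap.mul_apply', smul_eq_mul,
      ContinuousLinearMap.id_apply, MulOpposite.op_pow, mul_assoc]
    congr 1
    -- Cyclicity makes the p terms of the noncommutative power rule equal, so they add up as in the
    -- commutative case.
    have h2 : ∀ i ∈ Finset.range p, φ (x ^ (p.pred - i) * (h * x ^ i)) = φ (x ^ (p - 1) * h) := by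
      intro i hi
      rw [← mul_assoc, hφ, ← mul_assoc, ← pow_add]
      congr 3
      have := Finset.mem_range.mp hi
      rw [Nat.pred_eq_sub_one]
      omega
    calc _ = ∑ i ∈ Finset.range p, φ (x ^ (p.pred - i) * (h * x ^ i)) := by
          refine Finset.sum_congr rfl fun i _ => ?_
          simp [mul_assoc]
      _ = _ := by
          rw [Finset.sum_congr rfl h2]
          simp
  have hsucc : ∀ (p : ℕ) (x : 𝔸), g' (p + 1) x = ((p.factorial : ℂ)⁻¹) • L (x ^ p) := by
    intro p x
    simp only [hg', Nat.factorial_succ, Nat.add_sub_cancel]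
    congr 1
    have : ((p : ℂ) + 1) ≠ 0 := by exact_mod_cast p.succ_ne_zero
    push_cast
    field_simp
  have hLn : ∀ a, ‖L a‖ ≤ ‖φ‖ * ‖a‖ := fun a =>
    (ContinuousLinearMap.opNorm_comp_le _ _).trans
      (mul_le_mul_of_nonneg_left (ContinuousLinearMap.opNorm_mul_apply_le ℂ 𝔸 a) (norm_nonneg _))
  set R := ‖x‖ + 1 with hR
  -- The index shifts by one under differentiation and the zeroth derivative vanishes. The factor
  -- ‖1‖ is kept since the algebra is not assumed to have a unit of norm one.
  set u : ℕ → ℝ := fun p => match p with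
    | 0 => 0
    | p + 1 => ‖φ‖ * (‖(1 : 𝔸)‖ * (R ^ p / p.factorial)) with hu
  have hpow : ∀ (p : ℕ) (z : 𝔸), ‖z ^ p‖ ≤ ‖(1 : 𝔸)‖ * ‖z‖ ^ p := by
    intro p z
    induction p with
    | zero => simp
    | succ p ih =>
      rw [pow_succ, pow_succ, ← mul_assoc]
      exact (norm_mul_le _ _).trans (mul_le_mul_of_nonneg_right ih (norm_nonneg _))
  have hmain := hasFDerivAt_tsum_of_isPreconnected (u := u) (f := g) (f' := g')
    (s := Metric.ball 0 R) (x₀ := 0) (x := x) (𝕜 := ℂ) ?_ Metric.isOpen_ball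
    (convex_ball _ _).isPreconnected (fun p x _ => hder p x) ?_ ?_ ?_ ?_
  · rw [hexp]
    refine hmain.congr_fderiv ?_
    have h1 : HasSum (fun p => g' (p + 1) x) (L (NormedSpace.exp x)) := by
      have h2 := (hsum x).mapL
        ((ContinuousLinearMap.compL ℂ 𝔸 𝔸 ℂ φ).comp (ContinuousLinearMap.mul ℂ 𝔸))
      refine h2.congr_fun ?_
      intro p
      rw [hsucc]
      simp only [map_smul]
      rfl
    have h0 : g' 0 x = 0 := by simp only [hg', Nat.cast_zero, mul_zero]; exact zero_smul ℂ (L (x ^ (0 - 1)))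
    have h3 : HasSum (fun p => g' p x) (L (NormedSpace.exp x)) := by
      rw [← hasSum_nat_add_iff' 1]
      simpa [h0] using h1
    exact h3.tsum_eq
  · rw [← summable_nat_add_iff 1]
    exact ((Real.summable_pow_div_factorial R).mul_left _).mul_left _
  · intro p z hz
    rcases p with - | p
    · simp [hg', hu]
    · rw [hsucc, norm_smul, norm_inv, RCLike.norm_natCast]
      have hz' : ‖z‖ ≤ R := by simpa using (Metric.mem_ball.mp hz).le
      calc _ ≤ ((p.factorial : ℝ)⁻¹) * (‖φ‖ * (‖(1 : 𝔸)‖ * R ^ p)) := by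
            refine mul_le_mul_of_nonneg_left ((hLn _).trans ?_) (by positivity)
            gcongr
            exact (hpow p z).trans (by gcongr)
        _ = _ := by simp only [hu]; ring
  · simp [hR]; positivity
  · refine summable_of_ne_finset_zero (s := {0}) ?_
    intro p hp
    have hp : p ≠ 0 := by simpa using hp
    simp [hg, hp]
  · simp [hR]

/-! ### Real matrices over ℂ and the group exp(isA) -/

section Complexify

variable {ι : Type*}

/-- The complexification of a real matrix. -/
noncomputable def complexify (A : Matrix ι ι ℝ) : Matrix ι ι ℂ := A.map Complex.ofReal

/-- The complexification of a real vector. -/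
noncomputable def complexifyVec (u : ι → ℝ) : ι → ℂ := fun i => (u i : ℂ)

theorem complexify_mul [Fintype ι] (A B : Matrix ι ι ℝ) : complexify (A * B) = complexify A * complexify B :=
  Matrix.map_mul (f := Complex.ofRealHom)

theorem complexify_add (A B : Matrix ι ι ℝ) : complexify (A + B) = complexify A + complexify B := by
  ext i j; simp [complexify]

theorem complexify_smul (τ : ℝ) (A : Matrix ι ι ℝ) :
    complexify (τ • A) = (τ : ℂ) • complexify A := by
  ext i j; simp [complexify]

theorem complexify_vecMulVec (u w : ι → ℝ) :
    complexify (Matrix.vecMulVec u w) =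
      Matrix.vecMulVec (complexifyVec u) (complexifyVec w) := by
  ext i j; simp [complexify, complexifyVec, Matrix.vecMulVec_apply]

theorem complexifyVec_mulVec [Fintype ι] (A : Matrix ι ι ℝ) (u : ι → ℝ) :
    complexifyVec (A.mulVec u) = (complexify A).mulVec (complexifyVec u) := by
  ext i; simp [complexify, complexifyVec, Matrix.mulVec, dotProduct]

theorem complexify_one [DecidableEq ι] : complexify (1 : Matrix ι ι ℝ) = 1 := by
  simp [complexify]

end Complexify

section Propagator

variable {ι : Type*} [Fintype ι] [DecidableEq ι]

/-- The matrix `exp (i s A)`. -/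
noncomputable def propagator (A : Matrix ι ι ℝ) (s : ℂ) : Matrix ι ι ℂ :=
  NormedSpace.exp (s • (Complex.I • complexify A))

/-- The bilinear form `uᵀ exp (i s A) w`. -/
noncomputable def propForm (A : Matrix ι ι ℝ) (s : ℂ) (u w : ι → ℝ) : ℂ :=
  complexifyVec u ⬝ᵥ (propagator A s).mulVec (complexifyVec w)

variable {A : Matrix ι ι ℝ} (hA : A.IsHermitian)

/-- The coordinates of a vector in the eigenbasis of a symmetric matrix. -/
noncomputable def eigenCoord (u : ι → ℝ) : ι → ℝ :=
  (star (hA.eigenvectorUnitary : Matrix ι ι ℝ)).mulVec u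

theorem star_mul_eigenvectorUnitary :
    star (hA.eigenvectorUnitary : Matrix ι ι ℝ) * (hA.eigenvectorUnitary : Matrix ι ι ℝ) = 1 :=
  Unitary.coe_star_mul_self _

theorem eigenvectorUnitary_mul_star :
    (hA.eigenvectorUnitary : Matrix ι ι ℝ) * star (hA.eigenvectorUnitary : Matrix ι ι ℝ) = 1 :=
  Unitary.coe_mul_star_self _

theorem propagator_eq (s : ℂ) :
    propagator A s = complexify (hA.eigenvectorUnitary : Matrix ι ι ℝ) *
      Matrix.diagonal (fun j => Complex.exp (s * (Complex.I * hA.eigenvalues j))) *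
      complexify (star (hA.eigenvectorUnitary : Matrix ι ι ℝ)) := by
  set U : Matrix ι ι ℝ := (hA.eigenvectorUnitary : Matrix ι ι ℝ)
  have h1 : complexify U * complexify (star U) = 1 := by
    rw [← complexify_mul, eigenvectorUnitary_mul_star, complexify_one]
  have hinv : (complexify U)⁻¹ = complexify (star U) := Matrix.inv_eq_right_inv h1
  have hunit : IsUnit (complexify U) := by
    rw [Matrix.isUnit_iff_isUnit_det]
    exact Matrix.isUnit_det_of_right_inverse h1
  have hspec : A = U * Matrix.diagonal hA.eigenvalues * star U := by
    have := hA.spectral_theorem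
    rw [Unitary.conjStarAlgAut_apply] at this
    simpa using this
  have hexp : s • (Complex.I • complexify A) = complexify U *
      Matrix.diagonal (fun j => s * (Complex.I * hA.eigenvalues j)) * (complexify U)⁻¹ := by
    have hdiag : complexify (Matrix.diagonal hA.eigenvalues) =
        Matrix.diagonal fun j => (hA.eigenvalues j : ℂ) := by
      ext i j
      simp [complexify, Matrix.diagonal_apply, apply_ite Complex.ofReal]
    have hsm : Matrix.diagonal (fun j => s * (Complex.I * hA.eigenvalues j)) =
        s • (Complex.I • Matrix.diagonal fun j => (hA.eigenvalues j : ℂ)) := by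
      ext i j
      simp [Matrix.diagonal_apply]
    conv_lhs => rw [hspec, complexify_mul, complexify_mul, hdiag]
    rw [hinv, hsm]
    simp only [Matrix.mul_smul, Matrix.smul_mul]
  rw [propagator, hexp, Matrix.exp_conj _ _ hunit, Matrix.exp_diagonal, hinv]
  congr 3
  ext j
  rw [Pi.coe_exp, Complex.exp_eq_exp_ℂ]

/-- The form is the Fourier transform of the spectral measure of the pair u, w. Symmetry, continuity
in s and, since the exponentials are unimodular for real s, the contraction bound are all read off
from this sum. -/
theorem propForm_eq (s : ℂ) (u w : ι → ℝ) :
    propForm A s u w = ∑ j, Complex.exp (s * (Complex.I * hA.eigenvalues j)) *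
      ((eigenCoord hA u j * eigenCoord hA w j : ℝ) : ℂ) := by
  have h1 : Matrix.vecMul (complexifyVec u) (complexify (hA.eigenvectorUnitary : Matrix ι ι ℝ)) =
      complexifyVec (eigenCoord hA u) := by
    ext j
    simp [complexify, complexifyVec, eigenCoord, Matrix.vecMul, Matrix.mulVec, dotProduct, mul_comm,
      Matrix.star_apply]
  rw [propForm, propagator_eq hA, ← Matrix.mulVec_mulVec, ← Matrix.mulVec_mulVec,
    Matrix.dotProduct_mulVec, h1, ← complexifyVec_mulVec]
  simp only [dotProduct, Matrix.mulVec_diagonal]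
  refine Finset.sum_congr rfl fun j _ => ?_
  rw [eigenCoord, eigenCoord]
  simp only [complexifyVec]
  push_cast
  ring

theorem trace_propagator (s : ℂ) :
    (propagator A s).trace = ∑ j, Complex.exp (s * (Complex.I * hA.eigenvalues j)) := by
  rw [propagator_eq hA, Matrix.trace_mul_cycle, ← complexify_mul, star_mul_eigenvectorUnitary,
    complexify_one, Matrix.one_mul, Matrix.trace_diagonal]

theorem eigenCoord_dotProduct (u w : ι → ℝ) :
    eigenCoord hA u ⬝ᵥ eigenCoord hA w = u ⬝ᵥ w := by
  have h : Matrix.vecMul (eigenCoord hA u) (star (hA.eigenvectorUnitary : Matrix ι ι ℝ)) = u := by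
    have : eigenCoord hA u = Matrix.vecMul u (hA.eigenvectorUnitary : Matrix ι ι ℝ) := by
      ext j
      simp [eigenCoord, Matrix.vecMul, Matrix.mulVec, dotProduct, Matrix.star_apply, mul_comm]
    rw [this, Matrix.vecMul_vecMul, eigenvectorUnitary_mul_star, Matrix.vecMul_one]
  conv_lhs => rw [eigenCoord.eq_1 hA w, Matrix.dotProduct_mulVec, h]

theorem norm_exp_real_mul_I (s x : ℝ) : ‖Complex.exp ((s : ℂ) * (Complex.I * x))‖ = 1 := by
  rw [show (s : ℂ) * (Complex.I * x) = ((s * x : ℝ) : ℂ) * Complex.I by push_cast; ring]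
  exact Complex.norm_exp_ofReal_mul_I _

include hA

theorem norm_propForm_sq_le (s : ℝ) (u w : ι → ℝ) :
    ‖propForm A s u w‖ ^ 2 ≤ (u ⬝ᵥ u) * (w ⬝ᵥ w) := by
  have h1 : ‖propForm A s u w‖ ≤ ∑ j, |eigenCoord hA u j| * |eigenCoord hA w j| := by
    rw [propForm_eq hA]
    refine (norm_sum_le _ _).trans (Finset.sum_le_sum fun j _ => ?_)
    rw [norm_mul, norm_exp_real_mul_I, one_mul, Complex.norm_real, Real.norm_eq_abs, abs_mul]
  calc _ ≤ (∑ j, |eigenCoord hA u j| * |eigenCoord hA w j|) ^ 2 := by gcongr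
    _ ≤ (∑ j, |eigenCoord hA u j| ^ 2) * ∑ j, |eigenCoord hA w j| ^ 2 :=
      Finset.sum_mul_sq_le_sq_mul_sq _ _ _
    _ = _ := by
      rw [← eigenCoord_dotProduct hA u u, ← eigenCoord_dotProduct hA w w]
      simp [dotProduct, sq]

theorem norm_propForm_self_le (s : ℝ) (w : ι → ℝ) : ‖propForm A s w w‖ ≤ w ⬝ᵥ w := by
  have h0 : 0 ≤ w ⬝ᵥ w := by simpa using dotProduct_self_star_nonneg w
  exact abs_le_of_sq_le_sq' (by simpa [sq] using norm_propForm_sq_le hA s w w) h0 |>.2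

theorem propForm_comm (s : ℂ) (u w : ι → ℝ) : propForm A s u w = propForm A s w u := by
  rw [propForm_eq hA, propForm_eq hA]
  simp only [mul_comm (eigenCoord hA u _)]

theorem propForm_zero (u w : ι → ℝ) : propForm A 0 u w = ((u ⬝ᵥ w : ℝ) : ℂ) := by
  rw [propForm_eq hA, ← eigenCoord_dotProduct hA]
  simp [dotProduct]

theorem continuous_propForm (u w : ι → ℝ) : Continuous fun s : ℝ => propForm A s u w := by
  simp only [propForm_eq hA]
  fun_prop

/-- A single vector whose spectral measure is the normalized counting measure of eigenvalues. -/
theorem exists_propForm_eq_trace_div [Nonempty ι] :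
    ∃ v : ι → ℝ, v ⬝ᵥ v = 1 ∧
      ∀ s, propForm A s v v = (propagator A s).trace / (Fintype.card ι : ℂ) := by
  -- The vector with all eigenbasis coordinates equal to this c gives each eigenvalue the weight 1 /
  -- card.
  set c : ℝ := (Real.sqrt (Fintype.card ι))⁻¹
  have hc : c * c = (Fintype.card ι : ℝ)⁻¹ := by
    rw [← mul_inv, Real.mul_self_sqrt (by positivity)]
  set v := (hA.eigenvectorUnitary : Matrix ι ι ℝ).mulVec fun _ => c with hv
  have h1 : ∀ j, eigenCoord hA v j = c := by
    intro j
    rw [eigenCoord, hv, Matrix.mulVec_mulVec, star_mul_eigenvectorUnitary, Matrix.one_mulVec]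
  refine ⟨v, ?_, fun s => ?_⟩
  · rw [← eigenCoord_dotProduct hA]
    simp only [dotProduct, h1, hc]
    simp
  · rw [propForm_eq hA, trace_propagator hA, Finset.sum_div]
    refine Finset.sum_congr rfl fun j _ => ?_
    rw [h1, hc]
    push_cast
    rfl

end Propagator

theorem isHermitian_add_smul_vecMulVec {ι : Type*} {A : Matrix ι ι ℝ} (hA : A.IsHermitian) (τ : ℝ)
    (w : ι → ℝ) : (A + τ • Matrix.vecMulVec w w).IsHermitian := by
  refine hA.add ?_
  ext i j
  simp [Matrix.vecMulVec_apply, mul_comm]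

/-! ### Rank one perturbations: Duhamel's formula and rotation of the perturbing vector -/

section Perturbation

open scoped Matrix.Norms.L2Operator

variable {ι : Type*} [Fintype ι]

theorem mulVec_vecMulVec_mul (u w a b : ι → ℂ) (X Y : Matrix ι ι ℂ) :
    u ⬝ᵥ (X * Matrix.vecMulVec a b * Y).mulVec w =
      (u ⬝ᵥ X.mulVec a) * (b ⬝ᵥ Y.mulVec w) := by
  rw [← Matrix.mulVec_mulVec, ← Matrix.mulVec_mulVec, Matrix.vecMulVec_mulVec]
  simp [Matrix.mulVec_smul, mul_comm]

theorem trace_mul_smul_vecMulVec (X : Matrix ι ι ℂ) (c : ℂ) (a b : ι → ℂ) :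
    (X * (c • Matrix.vecMulVec a b)).trace = c * (b ⬝ᵥ X.mulVec a) := by
  rw [Matrix.mul_smul, Matrix.trace_smul, Matrix.mul_vecMulVec, Matrix.trace_vecMulVec,
    dotProduct_comm, smul_eq_mul]

theorem dotProduct_self_nonneg' (w : ι → ℝ) : 0 ≤ w ⬝ᵥ w := by
  simpa using dotProduct_self_star_nonneg w

variable [DecidableEq ι]

/-- The functional `X ↦ uᵀ X w` on matrices. -/
noncomputable def bilinCLM (u w : ι → ℂ) : Matrix ι ι ℂ →L[ℂ] ℂ :=
  LinearMap.toContinuousLinearMap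
    { toFun := fun X => u ⬝ᵥ X.mulVec w
      map_add' := fun X Y => by rw [Matrix.add_mulVec, dotProduct_add]
      map_smul' := fun c X => by simp [Matrix.smul_mulVec] }

/-- The trace as a continuous functional. -/
noncomputable def traceCLM : Matrix ι ι ℂ →L[ℂ] ℂ :=
  LinearMap.toContinuousLinearMap (Matrix.traceLinearMap ι ℂ ℂ)

theorem hasDerivAt_propagator (A : Matrix ι ι ℝ) (s : ℂ) :
    HasDerivAt (propagator A) (propagator A s * (Complex.I • complexify A)) s :=
  hasDerivAt_exp_smul_const _ s

theorem hasDerivAt_propagator' (A : Matrix ι ι ℝ) (s : ℂ) :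
    HasDerivAt (propagator A) ((Complex.I • complexify A) * propagator A s) s :=
  hasDerivAt_exp_smul_const' _ s

theorem propagator_zero (A : Matrix ι ι ℝ) : propagator A 0 = 1 := by
  simp [propagator]

/-- Duhamel's formula for a rank one perturbation. -/
theorem propForm_add_vecMulVec {A : Matrix ι ι ℝ} (hA : A.IsHermitian) (τ : ℝ) (u w : ι → ℝ) :
    propForm (A + τ • Matrix.vecMulVec w w) 1 u w = propForm A 1 u w +
      ∫ s : ℝ in (0 : ℝ)..1, Complex.I * τ * (propForm A ((1 - s : ℝ) : ℂ) u w *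
        propForm (A + τ • Matrix.vecMulVec w w) s w w) := by
  set B := A + τ • Matrix.vecMulVec w w with hB
  have hBh : B.IsHermitian := isHermitian_add_smul_vecMulVec hA τ w
  -- This interpolates between exp(iA) at s = 0 and exp(iB) at s = 1. In the derivative only B - A =
  -- τ w wᵀ survives, and its rank one splits the form into a product.
  set G : ℂ → ℂ := fun s => bilinCLM (complexifyVec u) (complexifyVec w)
    (propagator A (1 - s) * propagator B s) with hG
  have hder : ∀ s : ℂ, HasDerivAt G
      (Complex.I * τ * (propForm A (1 - s) u w * propForm B s w w)) s := by
    intro s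
    have h1 : HasDerivAt (fun s : ℂ => propagator A (1 - s))
        (-(propagator A (1 - s) * (Complex.I • complexify A))) s := by
      refine ((hasDerivAt_propagator A (1 - s)).scomp s
        ((hasDerivAt_id s).const_sub 1)).congr_deriv ?_
      rw [neg_smul, one_smul]
    have h2 := (bilinCLM (complexifyVec u) (complexifyVec w)).hasFDerivAt.comp_hasDerivAt s
      (h1.mul (hasDerivAt_propagator' B s))
    refine h2.congr_deriv ?_
    have h3 : -(propagator A (1 - s) * (Complex.I • complexify A)) * propagator B s +
        propagator A (1 - s) * ((Complex.I • complexify B) * propagator B s) =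
        (Complex.I * τ) • (propagator A (1 - s) *
          Matrix.vecMulVec (complexifyVec w) (complexifyVec w) * propagator B s) := by
      rw [hB, complexify_add, complexify_smul, complexify_vecMulVec, smul_add, smul_smul,
        add_mul, mul_add, ← mul_assoc, neg_mul, neg_add_cancel_left]
      simp only [Matrix.mul_smul, Matrix.smul_mul, mul_assoc]
    rw [h3, map_smul, smul_eq_mul]
    exact congrArg _ (mulVec_vecMulVec_mul _ _ _ _ _ _)
  have hint := intervalIntegral.integral_eq_sub_of_hasDerivAt (a := 0) (b := 1)
    (f := fun s : ℝ => G s)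
    (f' := fun s : ℝ => Complex.I * τ * (propForm A (1 - s) u w * propForm B s w w))
    (fun s _ => (hder s).comp_ofReal) ?_
  · have e1 : G (1 : ℝ) = propForm B 1 u w := by
      simp only [hG, Complex.ofReal_one, sub_self, propagator_zero, one_mul]
      rfl
    have e0 : G (0 : ℝ) = propForm A 1 u w := by
      simp only [hG, Complex.ofReal_zero, sub_zero, propagator_zero, mul_one]
      rfl
    rw [e1, e0] at hint
    push_cast
    rw [hint]
    ring
  · apply Continuous.intervalIntegrable
    have h1 : Continuous fun s : ℝ => propForm A (1 - s) u w := by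
      have := (continuous_propForm hA u w).comp (continuous_const.sub continuous_id : Continuous
        fun s : ℝ => (1 : ℝ) - s)
      simpa [Function.comp_def] using this
    exact continuous_const.mul (h1.mul (continuous_propForm hBh w w))

/-- In Duhamel's formula the factor with the perturbed matrix is bounded trivially by ‖w‖², and the
other one involves only A. Smallness of the mixed form for A is thus inherited by the perturbed
matrix. -/
theorem norm_propForm_add_vecMulVec_le {A : Matrix ι ι ℝ} (hA : A.IsHermitian) (τ : ℝ)
    (u w : ι → ℝ) :
    ‖propForm (A + τ • Matrix.vecMulVec w w) 1 u w‖ ≤ ‖propForm A 1 u w‖ +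
      |τ| * (w ⬝ᵥ w) * ∫ s : ℝ in (0 : ℝ)..1, ‖propForm A s u w‖ := by
  have hBh := isHermitian_add_smul_vecMulVec hA τ w
  have hc := (continuous_propForm hA u w).norm
  rw [propForm_add_vecMulVec hA]
  refine (norm_add_le _ _).trans (add_le_add le_rfl ?_)
  have hsub : ∫ s : ℝ in (0 : ℝ)..1, ‖propForm A s u w‖ =
      ∫ s : ℝ in (0 : ℝ)..1, ‖propForm A ((1 - s : ℝ) : ℂ) u w‖ := by
    rw [intervalIntegral.integral_comp_sub_left (fun s : ℝ => ‖propForm A s u w‖) 1]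
    simp
  rw [hsub, ← intervalIntegral.integral_const_mul]
  refine intervalIntegral.norm_integral_le_of_norm_le zero_le_one (ae_of_all _ fun s _ => ?_) ?_
  · rw [norm_mul, norm_mul, norm_mul, Complex.norm_I, one_mul, Complex.norm_real, Real.norm_eq_abs,
      mul_assoc |τ|]
    refine mul_le_mul_of_nonneg_left ?_ (abs_nonneg _)
    rw [mul_comm]
    exact mul_le_mul_of_nonneg_right (norm_propForm_self_le hBh s w) (norm_nonneg _)
  · exact (continuous_const.mul (hc.comp (continuous_const.sub continuous_id))).intervalIntegrable
      _ _

/-- Derivative of the trace of the propagator along a differentiable path. -/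
theorem hasDerivAt_trace_propagator {X : ℝ → Matrix ι ι ℝ} {X' : Matrix ι ι ℝ} {θ : ℝ}
    {Z : ℂ → Matrix ι ι ℂ} (hZ : ∀ θ : ℝ, Z θ = complexify (X θ))
    (hX : HasDerivAt Z (complexify X') θ) :
    HasDerivAt (fun θ : ℝ => (propagator (X θ) 1).trace)
      ((propagator (X θ) 1 * (Complex.I • complexify X')).trace) θ := by
  -- The derivative formula is complex linear, so the path is differentiated through its extension Z
  -- to a complex parameter and then restricted to real values.
  have h1 := (hasFDerivAt_tracial_exp (traceCLM (ι := ι)) (fun a b => Matrix.trace_mul_comm a b)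
    (Complex.I • Z θ)).comp_hasDerivAt (θ : ℂ) (hX.const_smul Complex.I)
  have h2 := h1.comp_ofReal
  simp only [Function.comp_def, Pi.smul_apply, hZ] at h2
  have e : ∀ A : Matrix ι ι ℝ, propagator A 1 = NormedSpace.exp (Complex.I • complexify A) :=
    fun A => by rw [propagator, one_smul]
  simp only [e]
  exact h2

/-- First order bound for the effect of a rank one perturbation. -/
theorem norm_trace_propagator_sub_le {A : Matrix ι ι ℝ} (hA : A.IsHermitian) (τ : ℝ) (w : ι → ℝ) :
    ‖(propagator (A + τ • Matrix.vecMulVec w w) 1).trace - (propagator A 1).trace‖ ≤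
      |τ| * (w ⬝ᵥ w) := by
  set X : ℝ → Matrix ι ι ℝ := fun x => A + (x * τ) • Matrix.vecMulVec w w with hX
  have hder : ∀ x : ℝ, HasDerivAt (fun x : ℝ => (propagator (X x) 1).trace)
      ((propagator (X x) 1 * (Complex.I • complexify (τ • Matrix.vecMulVec w w))).trace) x := by
    intro x
    refine hasDerivAt_trace_propagator
      (Z := fun x : ℂ => complexify A + x • complexify (τ • Matrix.vecMulVec w w)) ?_ ?_
    · intro x
      simp only [hX, complexify_add, complexify_smul, smul_smul]
      push_cast
      rfl
    · have := ((hasDerivAt_id (x : ℂ)).smul_const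
        (complexify (τ • Matrix.vecMulVec w w))).const_add (complexify A)
      simpa using this
  have hbd : ∀ x : ℝ, ‖(propagator (X x) 1 *
      (Complex.I • complexify (τ • Matrix.vecMulVec w w))).trace‖ ≤ |τ| * (w ⬝ᵥ w) := by
    intro x
    rw [complexify_smul, complexify_vecMulVec, smul_smul, trace_mul_smul_vecMulVec, norm_mul,
      norm_mul, Complex.norm_I, one_mul, Complex.norm_real, Real.norm_eq_abs]
    refine mul_le_mul_of_nonneg_left ?_ (abs_nonneg _)
    have := norm_propForm_self_le (isHermitian_add_smul_vecMulVec hA (x * τ) w) 1 w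
    rw [Complex.ofReal_one] at this
    exact this
  have := norm_image_sub_le_of_norm_deriv_le_segment_01'
    (f := fun x : ℝ => (propagator (X x) 1).trace) (fun x _ => (hder x).hasDerivWithinAt)
    (fun x _ => hbd x)
  simpa [hX] using this

/-- Comparison of two rank one perturbations with mutually orthogonal spectral measures. -/
theorem norm_trace_propagator_sub_le_of_orthogonal {A : Matrix ι ι ℝ} (hA : A.IsHermitian) (τ : ℝ)
    {a b : ι → ℝ} {R : ℝ} (hab : ∀ s : ℝ, propForm A s a b = 0)
    (ha : a ⬝ᵥ a ≤ R) (hb : b ⬝ᵥ b ≤ R) :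
    ‖(propagator (A + τ • Matrix.vecMulVec b b) 1).trace -
        (propagator (A + τ • Matrix.vecMulVec a a) 1).trace‖ ≤
      2 * |τ| * (‖propForm A 1 b b - propForm A 1 a a‖ +
        |τ| * R * ∫ s : ℝ in (0 : ℝ)..1, ‖propForm A s b b - propForm A s a a‖) := by
  set δ : ℝ → ℂ := fun s => propForm A s b b - propForm A s a a with hδ
  have hδc : Continuous δ := (continuous_propForm hA b b).sub (continuous_propForm hA a a)
  -- Rotate from a at θ = 0 to b at θ = π/2. By cyclicity the derivative of the trace is 2iτ w'ᵀ
  -- exp(iX) w.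
  set w : ℝ → ι → ℝ := fun θ => Real.cos θ • a + Real.sin θ • b with hw
  set w' : ℝ → ι → ℝ := fun θ => -Real.sin θ • a + Real.cos θ • b with hw'
  set X : ℝ → Matrix ι ι ℝ := fun θ => A + τ • Matrix.vecMulVec (w θ) (w θ) with hX
  set X' : ℝ → Matrix ι ι ℝ := fun θ =>
    τ • Matrix.vecMulVec (w' θ) (w θ) + τ • Matrix.vecMulVec (w θ) (w' θ) with hX'
  have hder : ∀ θ : ℝ, HasDerivAt (fun θ : ℝ => (propagator (X θ) 1).trace)
      ((propagator (X θ) 1 * (Complex.I • complexify (X' θ))).trace) θ := by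
    intro θ
    refine hasDerivAt_trace_propagator (Z := fun z : ℂ => complexify A + (τ : ℂ) •
      ((Complex.cos z * Complex.cos z) • complexify (Matrix.vecMulVec a a) +
        (Complex.sin z * Complex.sin z) • complexify (Matrix.vecMulVec b b) +
        (Complex.cos z * Complex.sin z) •
          complexify (Matrix.vecMulVec a b + Matrix.vecMulVec b a))) ?_ ?_
    · intro θ
      ext i j
      simp [hX, hw, complexify, Matrix.vecMulVec_apply]
      ring
    · have hc := Complex.hasDerivAt_cos (θ : ℂ)
      have hs := Complex.hasDerivAt_sin (θ : ℂ)
      refine (((((hc.mul hc).smul_const _).add ((hs.mul hs).smul_const _)).add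
        ((hc.mul hs).smul_const _)).const_smul (τ : ℂ)).const_add (complexify A)
        |>.congr_deriv ?_
      ext i j
      simp [hX', hw, hw', complexify, Matrix.vecMulVec_apply]
      ring
  have hXh : ∀ θ, (X θ).IsHermitian := fun θ => isHermitian_add_smul_vecMulVec hA τ (w θ)
  -- The mixed terms vanish by orthogonality, so w'ᵀ exp(isA) w is proportional to the difference of
  -- the two spectral transforms. This is why the derivative is small although a and b may be far
  -- apart.
  have hform : ∀ θ (s : ℝ), propForm A s (w' θ) (w θ) = (Real.cos θ * Real.sin θ : ℝ) * δ s := by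
    intro θ s
    have hlin : ∀ (c d e f : ℝ), propForm A s (c • a + d • b) (e • a + f • b) =
        (c * e : ℝ) * propForm A s a a + (d * f : ℝ) * propForm A s b b +
          (c * f + d * e : ℝ) * propForm A s a b := by
      intro c d e f
      have hsm : ∀ c d : ℝ, complexifyVec (c • a + d • b) =
          (c : ℂ) • complexifyVec a + (d : ℂ) • complexifyVec b := by
        intro c d; ext i; simp [complexifyVec]
      have hba := propForm_comm hA s a b
      simp only [propForm] at hba ⊢
      simp only [hsm, Matrix.mulVec_add, Matrix.mulVec_smul, dotProduct_add, add_dotProduct,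
        dotProduct_smul, smul_dotProduct, smul_eq_mul, ← hba]
      push_cast
      ring
    rw [hw', hw, hlin, hab, hδ]
    push_cast
    ring
  have hcs : ∀ θ : ℝ, |Real.cos θ * Real.sin θ| ≤ 1 / 2 := by
    intro θ
    rw [abs_le]
    constructor <;> nlinarith [Real.sin_sq_add_cos_sq θ, sq_nonneg (Real.cos θ + Real.sin θ),
      sq_nonneg (Real.cos θ - Real.sin θ)]
  have hww : ∀ θ, w θ ⬝ᵥ w θ ≤ R := by
    intro θ
    have hab0 : a ⬝ᵥ b = 0 := by
      have := hab 0
      rw [Complex.ofReal_zero, propForm_zero hA] at this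
      exact_mod_cast this
    have : w θ ⬝ᵥ w θ = Real.cos θ ^ 2 * (a ⬝ᵥ a) + Real.sin θ ^ 2 * (b ⬝ᵥ b) := by
      simp only [hw, dotProduct_add, add_dotProduct, dotProduct_smul, smul_dotProduct, smul_eq_mul,
        dotProduct_comm b a, hab0]
      ring
    rw [this]
    calc _ ≤ Real.cos θ ^ 2 * R + Real.sin θ ^ 2 * R := by gcongr
      _ = R := by rw [← add_mul, Real.cos_sq_add_sin_sq, one_mul]
  have hR : 0 ≤ R := (dotProduct_self_nonneg' a).trans ha
  have hI : 0 ≤ ∫ s : ℝ in (0 : ℝ)..1, ‖δ s‖ :=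
    intervalIntegral.integral_nonneg zero_le_one fun s _ => norm_nonneg _
  have hfb : ∀ θ (s : ℝ), ‖propForm A s (w' θ) (w θ)‖ ≤ 1 / 2 * ‖δ s‖ := by
    intro θ s
    rw [hform, norm_mul, Complex.norm_real, Real.norm_eq_abs]
    exact mul_le_mul_of_nonneg_right (hcs θ) (norm_nonneg _)
  have hbd : ∀ θ : ℝ, ‖(propagator (X θ) 1 * (Complex.I • complexify (X' θ))).trace‖ ≤
      |τ| * (‖δ 1‖ + |τ| * R * ∫ s : ℝ in (0 : ℝ)..1, ‖δ s‖) := by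
    intro θ
    have e : (propagator (X θ) 1 * (Complex.I • complexify (X' θ))).trace =
        2 * (Complex.I * τ) * propForm (X θ) 1 (w' θ) (w θ) := by
      rw [hX', complexify_add, complexify_smul, complexify_smul, complexify_vecMulVec,
        complexify_vecMulVec, smul_add, smul_smul, smul_smul, mul_add, Matrix.trace_add,
        trace_mul_smul_vecMulVec, trace_mul_smul_vecMulVec]
      have := propForm_comm (hXh θ) 1 (w' θ) (w θ)
      simp only [propForm] at this ⊢
      rw [← this]
      ring
    rw [e, norm_mul, norm_mul, norm_mul, Complex.norm_I, one_mul, Complex.norm_real,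
      Real.norm_eq_abs, RCLike.norm_ofNat]
    have h1 := norm_propForm_add_vecMulVec_le hA τ (w' θ) (w θ)
    have h2 : ∫ s : ℝ in (0 : ℝ)..1, ‖propForm A s (w' θ) (w θ)‖ ≤
        1 / 2 * ∫ s : ℝ in (0 : ℝ)..1, ‖δ s‖ := by
      rw [← intervalIntegral.integral_const_mul]
      exact intervalIntegral.integral_mono_on zero_le_one
        ((continuous_propForm hA _ _).norm.intervalIntegrable _ _)
        ((continuous_const.mul hδc.norm).intervalIntegrable _ _) fun s _ => hfb θ s
    have h3 : ‖propForm A 1 (w' θ) (w θ)‖ ≤ 1 / 2 * ‖δ 1‖ := by simpa using hfb θ 1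
    have h4 : |τ| * (w θ ⬝ᵥ w θ) * ∫ s : ℝ in (0 : ℝ)..1, ‖propForm A s (w' θ) (w θ)‖ ≤
        |τ| * R * (1 / 2 * ∫ s : ℝ in (0 : ℝ)..1, ‖δ s‖) := by
      refine mul_le_mul (mul_le_mul_of_nonneg_left (hww θ) (abs_nonneg _)) h2
        (intervalIntegral.integral_nonneg zero_le_one fun s _ => norm_nonneg _) (by positivity)
    have h5 : ‖propForm (X θ) 1 (w' θ) (w θ)‖ ≤
        1 / 2 * (‖δ 1‖ + |τ| * R * ∫ s : ℝ in (0 : ℝ)..1, ‖δ s‖) := by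
      refine (h1.trans (add_le_add h3 h4)).trans (le_of_eq ?_)
      ring
    nlinarith [mul_le_mul_of_nonneg_left h5 (abs_nonneg τ)]
  have hmv := norm_image_sub_le_of_norm_deriv_le_segment' (a := 0) (b := Real.pi / 2)
    (f := fun x : ℝ => (propagator (X x) 1).trace) (fun x _ => (hder x).hasDerivWithinAt)
    (fun x _ => hbd x) (Real.pi / 2) ⟨by positivity, le_rfl⟩
  simp only [hX, hw, Real.cos_pi_div_two, Real.sin_pi_div_two, Real.cos_zero, Real.sin_zero,
    zero_smul, one_smul, zero_add, add_zero, sub_zero] at hmv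
  refine hmv.trans ?_
  have hK : 0 ≤ |τ| * (‖δ 1‖ + |τ| * R * ∫ s : ℝ in (0 : ℝ)..1, ‖δ s‖) := by positivity
  -- The length of the θ-interval is rounded up to the factor 2 in the bound.
  have hpi : Real.pi / 2 ≤ 2 := by linarith [Real.pi_le_four]
  calc _ ≤ |τ| * (‖δ 1‖ + |τ| * R * ∫ s : ℝ in (0 : ℝ)..1, ‖δ s‖) * 2 := by gcongr
    _ = _ := by simp only [hδ, Complex.ofReal_one]; ring

end Perturbation

/-! ### Doubling the space to remove the orthogonality assumption -/

section Blocks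

variable {ι : Type*}

/-- Extension of a vector by zero to one of two copies of its index set. -/
def blockVec (b : Bool) (u : ι → ℝ) : ι × Bool → ℝ := fun p => if p.2 = b then u p.1 else 0

theorem blockDiagonal_add_smul_vecMulVec (A : Matrix ι ι ℝ) (τ : ℝ) (b : Bool) (w : ι → ℝ) :
    Matrix.blockDiagonal (fun _ : Bool => A) +
        τ • Matrix.vecMulVec (blockVec b w) (blockVec b w) =
      Matrix.blockDiagonal fun b' => if b' = b then A + τ • Matrix.vecMulVec w w else A := by
  ext ⟨i, p⟩ ⟨j, q⟩
  cases b <;> cases p <;> cases q <;>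
    simp [blockVec, Matrix.vecMulVec_apply, Matrix.blockDiagonal_apply]

theorem isHermitian_blockDiagonal {A : Matrix ι ι ℝ} (hA : A.IsHermitian) :
    (Matrix.blockDiagonal fun _ : Bool => A).IsHermitian := by
  rw [Matrix.IsHermitian, Matrix.blockDiagonal_conjTranspose]
  simp only [hA.eq]

variable [Fintype ι]

theorem blockVec_dotProduct_self (b : Bool) (u : ι → ℝ) :
    blockVec b u ⬝ᵥ blockVec b u = u ⬝ᵥ u := by
  cases b <;> simp [blockVec, dotProduct, Fintype.sum_prod_type]

variable [DecidableEq ι]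

open scoped Matrix.Norms.L2Operator in
theorem propagator_blockDiagonal (M : Bool → Matrix ι ι ℝ) (s : ℂ) :
    propagator (Matrix.blockDiagonal M) s = Matrix.blockDiagonal fun b => propagator (M b) s := by
  have h : s • (Complex.I • complexify (Matrix.blockDiagonal M)) =
      Matrix.blockDiagonal fun b => s • (Complex.I • complexify (M b)) := by
    ext p q
    simp [complexify, Matrix.blockDiagonal_apply, apply_ite Complex.ofReal]
  rw [propagator, h, Matrix.exp_blockDiagonal]
  congr 1
  ext b : 1
  let : NormedAlgebra ℚ (Matrix ι ι ℂ) := NormedAlgebra.restrictScalars ℚ ℂ _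
  exact Pi.coe_exp (𝔸 := fun _ : Bool => Matrix ι ι ℂ) _ b

theorem propForm_blockDiagonal (M : Bool → Matrix ι ι ℝ) (s : ℂ) (b b' : Bool) (u w : ι → ℝ) :
    propForm (Matrix.blockDiagonal M) s (blockVec b u) (blockVec b' w) =
      if b = b' then propForm (M b) s u w else 0 := by
  rw [propForm, propagator_blockDiagonal]
  cases b <;> cases b' <;>
    simp [propForm, dotProduct, Matrix.mulVec, complexifyVec, blockVec, Fintype.sum_prod_type,
      Matrix.blockDiagonal_apply]

/-- Comparison of two rank one perturbations of the same matrix. -/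
theorem norm_trace_propagator_sub_le_of_two {A : Matrix ι ι ℝ} (hA : A.IsHermitian) (τ : ℝ)
    {v y : ι → ℝ} {R : ℝ} (hv : v ⬝ᵥ v ≤ R) (hy : y ⬝ᵥ y ≤ R) :
    ‖(propagator (A + τ • Matrix.vecMulVec y y) 1).trace -
        (propagator (A + τ • Matrix.vecMulVec v v) 1).trace‖ ≤
      2 * |τ| * (‖propForm A 1 y y - propForm A 1 v v‖ +
        |τ| * R * ∫ s : ℝ in (0 : ℝ)..1, ‖propForm A s y y - propForm A s v v‖) := by
  -- In A ⊕ A the copies of v and y lie in different invariant blocks, so all mixed forms vanish.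
  -- Each perturbed trace contains one extra Tr exp(iA) from the untouched block, and these cancel.
  have h := norm_trace_propagator_sub_le_of_orthogonal (isHermitian_blockDiagonal hA) τ
    (a := blockVec false v) (b := blockVec true y) (R := R)
    (fun s => by rw [propForm_blockDiagonal]; simp)
    (by rwa [blockVec_dotProduct_self]) (by rwa [blockVec_dotProduct_self])
  simp only [propForm_blockDiagonal, if_true, blockDiagonal_add_smul_vecMulVec,
    propagator_blockDiagonal, Matrix.trace_blockDiagonal, Fintype.sum_bool] at h
  simp only [Bool.true_eq_false, Bool.false_eq_true, if_false] at h
  convert h using 2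
  ring

theorem sq_integral_zero_one_le {f : ℝ → ℝ} (hf : Continuous f) :
    (∫ s in (0 : ℝ)..1, f s) ^ 2 ≤ ∫ s in (0 : ℝ)..1, f s ^ 2 := by
  set c := ∫ s in (0 : ℝ)..1, f s with hc
  have h1 : 0 ≤ ∫ s in (0 : ℝ)..1, (f s - c) ^ 2 :=
    intervalIntegral.integral_nonneg zero_le_one fun s _ => sq_nonneg _
  have h2 : ∫ s in (0 : ℝ)..1, (f s - c) ^ 2 =
      (∫ s in (0 : ℝ)..1, f s ^ 2) - 2 * c * c + c ^ 2 := by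
    have e : (fun s => (f s - c) ^ 2) = fun s => f s ^ 2 - 2 * c * f s + c ^ 2 := by
      ext s; ring
    rw [e, intervalIntegral.integral_add, intervalIntegral.integral_sub,
      intervalIntegral.integral_const_mul, ← hc]
    · simp
    all_goals exact Continuous.intervalIntegrable (by fun_prop) _ _
  rw [h2] at h1
  linarith

/-- The deviation of the quadratic form of `exp (i s A)` at `y` from the normalized trace. -/
noncomputable def propDev (A : Matrix ι ι ℝ) (s : ℂ) (y : ι → ℝ) : ℂ :=
  propForm A s y y - (propagator A s).trace / (Fintype.card ι : ℂ)

/-- The trace of the propagator of a rank one perturbation `A + τ y yᵀ` is controlled, up to a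
constant independent of `y`, by the deviations of the quadratic forms of the propagator of `A`. -/
theorem exists_norm_trace_propagator_sub_sq_le [Nonempty ι] {A : Matrix ι ι ℝ}
    (hA : A.IsHermitian) (τ : ℝ) :
    ∃ c : ℂ, ∀ y : ι → ℝ, ‖(propagator (A + τ • Matrix.vecMulVec y y) 1).trace - c‖ ^ 2 ≤
      32 * (τ ^ 2 * ‖propDev A 1 y‖ ^ 2 + τ ^ 2 * ‖propDev A 0 y‖ ^ 2 +
        τ ^ 4 * ∫ s : ℝ in (0 : ℝ)..1, ‖propDev A s y‖ ^ 2) := by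
  obtain ⟨v, hv, hvs⟩ := exists_propForm_eq_trace_div hA
  -- The constant is the trace with y replaced by the vector v whose forms equal the normalized
  -- traces; the deviations at y then are differences of forms at y and v.
  refine ⟨(propagator (A + τ • Matrix.vecMulVec v v) 1).trace, fun y => ?_⟩
  have hdev : ∀ s, propDev A s y = propForm A s y y - propForm A s v v := fun s => by
    rw [propDev, hvs]
  have hcont : Continuous fun s : ℝ => ‖propDev A s y‖ := by
    simp only [hdev]
    exact ((continuous_propForm hA y y).sub (continuous_propForm hA v v)).norm
  have hI : 0 ≤ ∫ s : ℝ in (0 : ℝ)..1, ‖propDev A s y‖ ^ 2 :=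
    intervalIntegral.integral_nonneg zero_le_one fun s _ => sq_nonneg _
  have hJ := sq_integral_zero_one_le hcont
  have hτ4 : 0 ≤ τ ^ 4 := by positivity
  -- Truncating ‖y‖² keeps the bound quadratic in the deviations, so that no moments beyond the
  -- fourth are needed. Beyond 2 the crude bound |τ|(‖y‖² + 1) ≤ 3|τ|(‖y‖² - 1) suffices, as ‖y‖² -
  -- 1 is the deviation at s = 0.
  by_cases hy : y ⬝ᵥ y ≤ 2
  · have h := norm_trace_propagator_sub_le_of_two hA τ (v := v) (y := y) (R := 2)
      (by rw [hv]; norm_num) hy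
    simp only [← hdev] at h
    set d := ‖propDev A 1 y‖
    set J := ∫ s : ℝ in (0 : ℝ)..1, ‖propDev A s y‖
    calc _ ≤ (2 * |τ| * (d + |τ| * 2 * J)) ^ 2 := by gcongr
      _ = 4 * τ ^ 2 * (d + |τ| * 2 * J) ^ 2 := by rw [mul_pow, mul_pow, sq_abs]; ring
      _ ≤ 4 * τ ^ 2 * (2 * d ^ 2 + 2 * (|τ| * 2 * J) ^ 2) := by
          gcongr
          nlinarith [sq_nonneg (d - |τ| * 2 * J)]
      _ = 8 * (τ ^ 2 * d ^ 2) + 32 * (τ ^ 4 * J ^ 2) := by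
          rw [mul_pow, mul_pow, sq_abs]; ring
      _ ≤ _ := by
          have h1 := mul_le_mul_of_nonneg_left hJ hτ4
          have h2 : 0 ≤ τ ^ 2 * d ^ 2 := by positivity
          have h3 : 0 ≤ τ ^ 2 * ‖propDev A 0 y‖ ^ 2 := by positivity
          linarith
  · push Not at hy
    have h0 : propDev A 0 y = ((y ⬝ᵥ y - 1 : ℝ) : ℂ) := by
      rw [hdev, propForm_zero hA, propForm_zero hA, hv]
      push_cast
      rfl
    have h1 := norm_trace_propagator_sub_le hA τ y
    have h2 := norm_trace_propagator_sub_le hA τ v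
    rw [hv] at h2
    have h3 : ‖(propagator (A + τ • Matrix.vecMulVec y y) 1).trace -
        (propagator (A + τ • Matrix.vecMulVec v v) 1).trace‖ ≤ |τ| * (3 * (y ⬝ᵥ y - 1)) := by
      calc _ ≤ |τ| * (y ⬝ᵥ y) + |τ| * 1 := by
            refine (norm_sub_le_norm_sub_add_norm_sub _ (propagator A 1).trace _).trans ?_
            rw [norm_sub_rev (propagator A 1).trace]
            exact add_le_add h1 h2
        _ ≤ _ := by nlinarith [abs_nonneg τ]
    calc _ ≤ (|τ| * (3 * (y ⬝ᵥ y - 1))) ^ 2 := by gcongr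
      _ = 9 * (τ ^ 2 * ‖propDev A 0 y‖ ^ 2) := by
          rw [h0, Complex.norm_real, Real.norm_eq_abs, sq_abs, mul_pow, sq_abs]; ring
      _ ≤ _ := by
          have h4 : 0 ≤ τ ^ 2 * ‖propDev A 1 y‖ ^ 2 := by positivity
          have h5 : 0 ≤ τ ^ 2 * ‖propDev A 0 y‖ ^ 2 := by positivity
          have h6 := mul_nonneg hτ4 hI
          linarith

end Blocks

/-! ### Averaging over a random rank one term -/

section Deviation

variable {ι : Type*} [Fintype ι] [DecidableEq ι]

theorem continuous_propDev {A : Matrix ι ι ℝ} (hA : A.IsHermitian) :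
    Continuous fun p : (ι → ℝ) × ℝ => propDev A (p.2 : ℂ) p.1 := by
  have h : Continuous fun u : ι → ℝ => eigenCoord hA u := by
    unfold eigenCoord
    exact Continuous.matrix_mulVec continuous_const continuous_id
  simp only [propDev, propForm_eq hA, trace_propagator hA]
  have h' : ∀ j, Continuous fun u : ι → ℝ => eigenCoord hA u j := fun j =>
    (continuous_apply j).comp h
  fun_prop

theorem re_propForm (A : Matrix ι ι ℝ) (s : ℂ) (x y : ι → ℝ) :
    x ⬝ᵥ ((propagator A s).map Complex.re).mulVec y = (propForm A s x y).re := by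
  simp [propForm, dotProduct, Matrix.mulVec, complexifyVec]

theorem im_propForm (A : Matrix ι ι ℝ) (s : ℂ) (x y : ι → ℝ) :
    x ⬝ᵥ ((propagator A s).map Complex.im).mulVec y = (propForm A s x y).im := by
  simp [propForm, dotProduct, Matrix.mulVec, complexifyVec]

end Deviation

section RankOneUpdate

variable {k n : ℕ} {μ : Measure (Fin n → ℝ)} {C : ℝ}

/-- Since exp(isA) is a contraction for real s, its real and imaginary parts are real matrices of
norm at most one. The concentration bound with κ = 1 applies to each, whence the factor 2. -/
theorem lintegral_propDev_sq_le [IsProbabilityMeasure μ] (hiso : IsNormalizedIsotropic μ)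
    (hunc : IsUnconditional μ) (h : FourthMomentBounds μ C) (hC : 0 ≤ C) (hn : 2 ≤ n)
    {A : Matrix (Fin k → Fin n) (Fin k → Fin n) ℝ} (hA : A.IsHermitian) (s : ℝ) :
    ∫⁻ Y, ENNReal.ofReal (‖propDev A s (tensorVec Y)‖ ^ 2) ∂(Measure.pi fun _ : Fin k => μ) ≤
      ENNReal.ofReal (2 * tensorQuadConst C k / n) := by
  have hre := lintegral_tensor_quadForm_sub_le hiso hunc h hC hn k
    (H := (propagator A s).map Complex.re) (κ := 1) (fun x y => by
      rw [re_propForm, one_mul]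
      refine le_trans ?_ (norm_propForm_sq_le hA s x y)
      rw [← sq_abs]
      gcongr
      exact Complex.abs_re_le_norm _)
  have him := lintegral_tensor_quadForm_sub_le hiso hunc h hC hn k
    (H := (propagator A s).map Complex.im) (κ := 1) (fun x y => by
      rw [im_propForm, one_mul]
      refine le_trans ?_ (norm_propForm_sq_le hA s x y)
      rw [← sq_abs]
      gcongr
      exact Complex.abs_im_le_norm _)
  have hcard : (Fintype.card (Fin k → Fin n) : ℂ) = (((n : ℝ) ^ k : ℝ) : ℂ) := by simp
  have hsplit : ∀ Y : Fin k → Fin n → ℝ, ENNReal.ofReal (‖propDev A s (tensorVec Y)‖ ^ 2) =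
      ENNReal.ofReal ((tensorVec Y ⬝ᵥ ((propagator A s).map Complex.re).mulVec (tensorVec Y) -
        ((propagator A s).map Complex.re).trace / (n : ℝ) ^ k) ^ 2) +
      ENNReal.ofReal ((tensorVec Y ⬝ᵥ ((propagator A s).map Complex.im).mulVec (tensorVec Y) -
        ((propagator A s).map Complex.im).trace / (n : ℝ) ^ k) ^ 2) := by
    intro Y
    have t1 : ((propagator A s).map Complex.re).trace = ((propagator A s).trace).re := by
      simp [Matrix.trace]
    have t2 : ((propagator A s).map Complex.im).trace = ((propagator A s).trace).im := by
      simp [Matrix.trace]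
    rw [← ENNReal.ofReal_add (sq_nonneg _) (sq_nonneg _), re_propForm, im_propForm, t1, t2, propDev,
      hcard, Complex.sq_norm, Complex.normSq_apply, Complex.sub_re, Complex.sub_im,
      Complex.div_ofReal_re, Complex.div_ofReal_im]
    congr 1
    ring
  have hm : Measurable fun Y : Fin k → Fin n → ℝ => ENNReal.ofReal
      ((tensorVec Y ⬝ᵥ ((propagator A s).map Complex.re).mulVec (tensorVec Y) -
        ((propagator A s).map Complex.re).trace / (n : ℝ) ^ k) ^ 2) :=
    ((((measurable_dotProduct_mulVec _).comp measurable_tensorVec).sub_const _).pow_const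
        2).ennreal_ofReal
  simp only [hsplit]
  rw [lintegral_add_left hm]
  refine (add_le_add hre him).trans (le_of_eq ?_)
  have := tensorQuadConst_nonneg hC k
  rw [← ENNReal.ofReal_add (by positivity) (by positivity)]
  congr 1
  ring

theorem lintegral_endpoints_add_lintegral_le {Ω : Type*} [MeasurableSpace Ω] {ρ : Measure Ω}
    [IsProbabilityMeasure ρ] {g : Ω → ℝ → ENNReal} (hg : Measurable fun p : Ω × ℝ => g p.1 p.2)
    {D a b : ENNReal} (hD : ∀ s, ∫⁻ ω, g ω s ∂ρ ≤ D) :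
    ∫⁻ ω, (a * g ω 1 + a * g ω 0 + b * ∫⁻ s in Set.Ioc 0 1, g ω s) ∂ρ ≤ a * D + a * D + b * D := by
  have hm : ∀ s : ℝ, Measurable fun ω => g ω s := fun s =>
    hg.comp (measurable_id.prodMk measurable_const)
  have hdouble : ∫⁻ ω, (∫⁻ s in Set.Ioc 0 1, g ω s) ∂ρ ≤ D := by
    rw [lintegral_lintegral_swap hg.aemeasurable]
    calc _ ≤ ∫⁻ _s : ℝ in Set.Ioc 0 1, D := lintegral_mono fun s => hD s
      _ = _ := by simp
  have hI : Measurable fun ω => ∫⁻ s in Set.Ioc 0 1, g ω s := hg.lintegral_prod_right'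
  rw [lintegral_add_right _ (hI.const_mul b), lintegral_add_right _ ((hm 0).const_mul a),
    lintegral_const_mul _ (hm 1),
    lintegral_const_mul _ (hm 0), lintegral_const_mul _ hI]
  gcongr
  · exact hD 1
  · exact hD 0

theorem ofReal_norm_trace_propagator_sub_sq_le {A : Matrix (Fin k → Fin n) (Fin k → Fin n) ℝ}
    (hA : A.IsHermitian) (τ : ℝ) [Nonempty (Fin k → Fin n)] :
    ∃ c : ℂ, ∀ y, ENNReal.ofReal (‖(propagator (A + τ •
        Matrix.vecMulVec y y) 1).trace - c‖ ^ 2) ≤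
      ENNReal.ofReal (32 * τ ^ 2) * ENNReal.ofReal (‖propDev A ((1 : ℝ) : ℂ) y‖ ^ 2) +
      ENNReal.ofReal (32 * τ ^ 2) * ENNReal.ofReal (‖propDev A ((0 : ℝ) : ℂ) y‖ ^ 2) +
      ENNReal.ofReal (32 * τ ^ 4) *
        ∫⁻ s : ℝ in Set.Ioc 0 1, ENNReal.ofReal (‖propDev A s y‖ ^ 2) := by
  obtain ⟨c, hc⟩ := exists_norm_trace_propagator_sub_sq_le hA τ
  refine ⟨c, fun y => ?_⟩
  have hcont : Continuous fun s : ℝ => ‖propDev A s y‖ ^ 2 :=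
    ((continuous_propDev hA).comp (continuous_const.prodMk continuous_id)).norm.pow 2
  have hint : ENNReal.ofReal (∫ s : ℝ in (0 : ℝ)..1, ‖propDev A s y‖ ^ 2) =
      ∫⁻ s : ℝ in Set.Ioc 0 1, ENNReal.ofReal (‖propDev A s y‖ ^ 2) := by
    rw [intervalIntegral.integral_of_le zero_le_one, ofReal_integral_eq_lintegral_ofReal]
    · exact (hcont.intervalIntegrable 0 1).1
    · exact ae_of_all _ fun s => sq_nonneg _
  have hI : 0 ≤ ∫ s : ℝ in (0 : ℝ)..1, ‖propDev A s y‖ ^ 2 :=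
    intervalIntegral.integral_nonneg zero_le_one fun s _ => sq_nonneg _
  rw [← hint, ← ENNReal.ofReal_mul (by positivity), ← ENNReal.ofReal_mul (by positivity),
    ← ENNReal.ofReal_mul (by positivity), ← ENNReal.ofReal_add (by positivity) (by positivity),
    ← ENNReal.ofReal_add (by positivity) (by positivity)]
  apply ENNReal.ofReal_le_ofReal
  refine (hc y).trans (le_of_eq ?_)
  simp only [Complex.ofReal_one, Complex.ofReal_zero]
  ring

/-- The trace of the propagator of a random rank one perturbation is concentrated. -/
theorem exists_lintegral_trace_propagator_sub_sq_le [IsProbabilityMeasure μ]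
    (hiso : IsNormalizedIsotropic μ) (hunc : IsUnconditional μ) (h : FourthMomentBounds μ C)
    (hC : 0 ≤ C) (hn : 2 ≤ n) {A : Matrix (Fin k → Fin n) (Fin k → Fin n) ℝ} (hA : A.IsHermitian)
    (τ : ℝ) :
    ∃ c : ℂ, ∫⁻ Y, ENNReal.ofReal (‖(propagator (A + τ •
        Matrix.vecMulVec (tensorVec Y) (tensorVec Y)) 1).trace - c‖ ^ 2)
          ∂(Measure.pi fun _ : Fin k => μ) ≤
      ENNReal.ofReal (64 * tensorQuadConst C k * (2 * τ ^ 2 + τ ^ 4) / n) := by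
  have : Nonempty (Fin n) := ⟨⟨0, by omega⟩⟩
  obtain ⟨c, hc⟩ := ofReal_norm_trace_propagator_sub_sq_le hA τ
  refine ⟨c, (lintegral_mono fun Y => hc (tensorVec Y)).trans ?_⟩
  have hjoint : Measurable fun p : (Fin k → Fin n → ℝ) × ℝ =>
      ENNReal.ofReal (‖propDev A (p.2 : ℂ) (tensorVec p.1)‖ ^ 2) := by
    have h1 : Measurable fun p : (Fin k → Fin n → ℝ) × ℝ => (tensorVec p.1, p.2) :=
      (measurable_tensorVec.comp measurable_fst).prodMk measurable_snd
    exact (((continuous_propDev hA).measurable.comp h1).norm.pow_const 2).ennreal_ofReal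
  refine (lintegral_endpoints_add_lintegral_le
    (g := fun (Y : Fin k → Fin n → ℝ) (s : ℝ) =>
      ENNReal.ofReal (‖propDev A (s : ℂ) (tensorVec Y)‖ ^ 2)) hjoint
    (lintegral_propDev_sq_le (k := k) hiso hunc h hC hn hA)).trans (le_of_eq ?_)
  have := tensorQuadConst_nonneg hC k
  rw [← ENNReal.ofReal_mul (by positivity), ← ENNReal.ofReal_mul (by positivity),
    ← ENNReal.ofReal_add (by positivity) (by positivity),
    ← ENNReal.ofReal_add (by positivity) (by positivity)]
  congr 1
  ring

end RankOneUpdate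

/-! ### The Efron–Stein inequality -/

section EfronStein

theorem Measurable.memLp_two_of_abs_le {X : Type*} [MeasurableSpace X] {ρ : Measure X}
    [IsProbabilityMeasure ρ] {f : X → ℝ} (hf : Measurable f) {K : ℝ} (hK : ∀ x, |f x| ≤ K) :
    MemLp f 2 ρ :=
  MemLp.of_bound hf.aestronglyMeasurable K (ae_of_all _ hK)

variable {X Z : Type*} [MeasurableSpace X] [MeasurableSpace Z] {ρ : Measure X} {ν : Measure Z}
  [IsProbabilityMeasure ρ] [IsProbabilityMeasure ν] {f : X × Z → ℝ} {K b : ℝ}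

theorem integral_abs_le_of_abs_le {f : X → ℝ} (hK : ∀ x, |f x| ≤ K) : |∫ x, f x ∂ρ| ≤ K := by
  simpa using norm_integral_le_of_norm_le_const (μ := ρ) (f := f) (ae_of_all _ hK)

/-- This is the law of total variance, with the conditional variance in the first variable replaced
by its uniform bound. -/
theorem variance_prod_le (hf : Measurable f) (hK : ∀ p, |f p| ≤ K)
    (hb : ∀ z, variance (fun x => f (x, z)) ρ ≤ b) :
    variance f (ρ.prod ν) ≤ b + variance (fun z => ∫ x, f (x, z) ∂ρ) ν := by
  have hG : Measurable fun z => ∫ x, f (x, z) ∂ρ :=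
    (hf.stronglyMeasurable.integral_prod_left').measurable
  have hGK : ∀ z, |∫ x, f (x, z) ∂ρ| ≤ K := fun z => integral_abs_le_of_abs_le fun x => hK _
  have hfint : Integrable f (ρ.prod ν) := (hf.memLp_two_of_abs_le hK).integrable one_le_two
  have hf2 : Integrable (fun p => f p ^ 2) (ρ.prod ν) :=
    (hf.memLp_two_of_abs_le hK).integrable_sq
  have hG2 : Integrable (fun z => (∫ x, f (x, z) ∂ρ) ^ 2) ν :=
    (hG.memLp_two_of_abs_le hGK).integrable_sq
  rw [variance_eq_sub (hf.memLp_two_of_abs_le hK), variance_eq_sub (hG.memLp_two_of_abs_le hGK)]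
  simp only [Pi.pow_apply]
  rw [integral_prod_symm _ hf2, integral_prod_symm _ hfint]
  have hz : ∀ z, ∫ x, f (x, z) ^ 2 ∂ρ ≤ b + (∫ x, f (x, z) ∂ρ) ^ 2 := by
    intro z
    have hfz : Measurable fun x => f (x, z) := hf.comp (measurable_id.prodMk measurable_const)
    have := hb z
    rw [variance_eq_sub (hfz.memLp_two_of_abs_le fun x => hK _)] at this
    simp only [Pi.pow_apply] at this
    linarith
  have hle : ∫ z, ∫ x, f (x, z) ^ 2 ∂ρ ∂ν ≤ ∫ z, (b + (∫ x, f (x, z) ∂ρ) ^ 2) ∂ν :=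
    integral_mono hf2.integral_prod_right ((integrable_const b).add hG2) hz
  rw [integral_add (integrable_const b) hG2] at hle
  simp only [integral_const, probReal_univ, one_smul] at hle
  linarith

/-- Averaging over an independent variable cannot raise a uniform variance bound: center f for each
fixed x, apply Jensen to the average over x, and exchange the integrals. -/
theorem variance_integral_le (hf : Measurable f) (hK : ∀ p, |f p| ≤ K)
    (hb : ∀ x, variance (fun z => f (x, z)) ν ≤ b) :
    variance (fun z => ∫ x, f (x, z) ∂ρ) ν ≤ b := by
  have hG : Measurable fun z => ∫ x, f (x, z) ∂ρ :=
    (hf.stronglyMeasurable.integral_prod_left').measurable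
  have hfint : Integrable f (ρ.prod ν) := (hf.memLp_two_of_abs_le hK).integrable one_le_two
  set e : X → ℝ := fun x => ∫ z, f (x, z) ∂ν with he
  have hem : Measurable e := (hf.stronglyMeasurable.integral_prod_right').measurable
  have heK : ∀ x, |e x| ≤ K := fun x => integral_abs_le_of_abs_le fun z => hK _
  set g : X × Z → ℝ := fun p => f p - e p.1 with hg
  have hgm : Measurable g := hf.sub (hem.comp measurable_fst)
  have hgK : ∀ p, |g p| ≤ K + K := fun p => (abs_sub _ _).trans (add_le_add (hK _) (heK _))
  have hg2 : Integrable (fun p => g p ^ 2) (ρ.prod ν) :=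
    (hgm.memLp_two_of_abs_le hgK).integrable_sq
  have hfz : ∀ z, Measurable fun x => f (x, z) := fun z =>
    hf.comp (measurable_id.prodMk measurable_const)
  have hgz : ∀ z, Measurable fun x => g (x, z) := fun z =>
    hgm.comp (measurable_id.prodMk measurable_const)
  have hmean : ∫ z, ∫ x, f (x, z) ∂ρ ∂ν = ∫ x, e x ∂ρ := by
    rw [← integral_prod_symm _ hfint, integral_prod _ hfint]
  have hcen : ∀ z, (∫ x, f (x, z) ∂ρ) - ∫ x, e x ∂ρ = ∫ x, g (x, z) ∂ρ := fun z =>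
    (integral_sub (((hfz z).memLp_two_of_abs_le fun x => hK _).integrable one_le_two)
      ((hem.memLp_two_of_abs_le heK).integrable one_le_two)).symm
  rw [variance_eq_integral hG.aemeasurable, hmean]
  simp only [hcen]
  have hjensen : ∀ z, (∫ x, g (x, z) ∂ρ) ^ 2 ≤ ∫ x, g (x, z) ^ 2 ∂ρ := by
    intro z
    have h1 := variance_nonneg (fun x => g (x, z)) ρ
    rw [variance_eq_sub ((hgz z).memLp_two_of_abs_le fun x => hgK _)] at h1
    simp only [Pi.pow_apply] at h1
    linarith
  have hgG : Measurable fun z => ∫ x, g (x, z) ∂ρ :=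
    (hgm.stronglyMeasurable.integral_prod_left').measurable
  calc _ ≤ ∫ z, ∫ x, g (x, z) ^ 2 ∂ρ ∂ν :=
        integral_mono (hgG.memLp_two_of_abs_le fun z =>
          integral_abs_le_of_abs_le fun x => hgK _).integrable_sq hg2.integral_prod_right hjensen
    _ = ∫ x, ∫ z, g (x, z) ^ 2 ∂ν ∂ρ := by
        rw [← integral_prod_symm _ hg2, integral_prod _ hg2]
    _ ≤ ∫ _x, b ∂ρ := by
        refine integral_mono hg2.integral_prod_left (integrable_const b) fun x => ?_
        have hfx : Measurable fun z => f (x, z) := hf.comp (measurable_const.prodMk measurable_id)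
        have := hb x
        rwa [variance_eq_integral hfx.aemeasurable] at this
    _ = b := by simp

/-- The Efron-Stein inequality for a bounded function of independent identically distributed
variables, with uniform bounds for the conditional variances. -/
theorem variance_pi_le {m : ℕ} : ∀ {F : (Fin m → X) → ℝ}, Measurable F → (∀ x, |F x| ≤ K) →
    ∀ {b : Fin m → ℝ},
    (∀ α x, variance (fun y => F (Function.update x α y)) ρ ≤ b α) →
    variance F (Measure.pi fun _ : Fin m => ρ) ≤ ∑ α, b α := by
  induction m with
  | zero =>
    intro F _ _ b _
    have : F = fun _ => F default := by
      ext x; rw [Subsingleton.elim x default]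
    rw [this, variance_eq_integral measurable_const.aemeasurable]
    simp
  | succ m ih =>
    intro F hF hK b hb
    have hmp := measurePreserving_finCons ρ m
    set f : X × (Fin m → X) → ℝ := fun z => F (Fin.cons z.1 z.2) with hf
    have hfm : Measurable f := hF.comp hmp.measurable
    have h1 : variance F (Measure.pi fun _ : Fin (m + 1) => ρ) =
        variance f (ρ.prod (Measure.pi fun _ : Fin m => ρ)) := by
      rw [← hmp.map_eq, variance_map hF.aemeasurable hmp.measurable.aemeasurable]
      rfl
    have hX : Nonempty X := nonempty_of_isProbabilityMeasure ρ
    rw [h1, Fin.sum_univ_succ]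
    -- The first coordinate contributes its conditional variance; what remains is the average over
    -- it, a function of m coordinates whose conditional variances obey the same bounds.
    refine (variance_prod_le hfm (fun p => hK _) (b := b 0) fun z => ?_).trans
      (add_le_add le_rfl ?_)
    · have := hb 0 (Fin.cons hX.some z)
      simpa [hf, Fin.update_cons_zero] using this
    · refine ih ?_ (fun z => integral_abs_le_of_abs_le fun x => hK _) fun α z => ?_
      · exact (hfm.stronglyMeasurable.integral_prod_left').measurable
      · refine variance_integral_le (f := fun p : X × X => f (p.1, Function.update z α p.2))
          ?_ (fun p => hK _) fun x => ?_
        · refine hfm.comp (measurable_fst.prodMk ?_)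
          exact (measurable_update z).comp measurable_snd
        · have := hb α.succ (Fin.cons x z)
          simpa [hf, Fin.cons_update] using this

end EfronStein

/-! ### Variance of Tr exp(it𝓜) -/

section TraceVariance

open scoped Matrix.Norms.L2Operator in
theorem continuous_trace_propagator {k m n : ℕ} (τ : Fin m → ℝ) :
    Continuous fun p : ℝ × (Fin m → Fin k → Fin n → ℝ) =>
      (propagator (tensorCov τ p.2) (p.1 : ℂ)).trace := by
  let : NormedAlgebra ℚ (Matrix (Fin k → Fin n) (Fin k → Fin n) ℂ) :=
    NormedAlgebra.restrictScalars ℚ ℂ _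
  have h1 : Continuous fun p : ℝ × (Fin m → Fin k → Fin n → ℝ) =>
      (p.1 : ℂ) • (Complex.I • complexify (tensorCov τ p.2)) := by
    refine continuous_matrix fun i j => ?_
    simp only [complexify, tensorCov, tensorVec, Matrix.smul_apply, Matrix.map_apply,
      Matrix.sum_apply, Matrix.vecMulVec_apply]
    fun_prop
  exact (NormedSpace.exp_continuous.comp h1).matrix_trace

theorem norm_trace_propagator_le {ι : Type*} [Fintype ι] [DecidableEq ι] {A : Matrix ι ι ℝ}
    (hA : A.IsHermitian) (t : ℝ) : ‖(propagator A t).trace‖ ≤ Fintype.card ι := by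
  rw [trace_propagator hA]
  refine (norm_sum_le _ _).trans ?_
  simp [norm_exp_real_mul_I]

/-- The time can be absorbed into the coefficients τ_α, so the perturbation bounds are needed at
time one only. -/
theorem propagator_ofReal_eq {ι : Type*} [Fintype ι] [DecidableEq ι] (A : Matrix ι ι ℝ) (t : ℝ) :
    propagator A t = propagator (t • A) 1 := by
  rw [propagator, propagator, complexify_smul, one_smul, smul_comm]

theorem smul_tensorCov {k m n : ℕ} (t : ℝ) (τ : Fin m → ℝ) (Y : Fin m → Fin k → Fin n → ℝ) :
    t • tensorCov τ Y = tensorCov (fun α => t * τ α) Y := by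
  simp only [tensorCov, Finset.smul_sum, smul_smul]

/-- Setting the coefficient of a sample to zero removes its summand while keeping the index set; the
remaining matrix no longer depends on the resampled Y_α. -/
theorem tensorCov_update {k m n : ℕ} (τ : Fin m → ℝ) (Y : Fin m → Fin k → Fin n → ℝ) (α : Fin m)
    (y : Fin k → Fin n → ℝ) :
    tensorCov τ (Function.update Y α y) = tensorCov (Function.update τ α 0) Y +
      τ α • Matrix.vecMulVec (tensorVec y) (tensorVec y) := by
  simp only [tensorCov]
  rw [← Finset.add_sum_erase _ _ (Finset.mem_univ α),
    ← Finset.add_sum_erase (a := α) _ _ (Finset.mem_univ α)]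
  simp only [Function.update_self, zero_smul, zero_add]
  rw [add_comm]
  congr 1
  refine Finset.sum_congr rfl fun β hβ => ?_
  have hβ : β ≠ α := Finset.ne_of_mem_erase hβ
  rw [Function.update_of_ne hβ, Function.update_of_ne hβ]

variable {k m n : ℕ} {μ : Measure (Fin n → ℝ)} {C : ℝ}

/-- The mean minimizes the mean square deviation, so any constant may serve as center. -/
theorem variance_le_of_lintegral_sub_sq_le {X : Type*} [MeasurableSpace X] {ρ : Measure X}
    [IsProbabilityMeasure ρ] {f : X → ℝ} (hf : Measurable f) {c b : ℝ} (hb : 0 ≤ b)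
    (h : ∫⁻ x, ENNReal.ofReal ((f x - c) ^ 2) ∂ρ ≤ ENNReal.ofReal b) : variance f ρ ≤ b := by
  rw [← variance_sub_const hf.aestronglyMeasurable c]
  refine (variance_le_expectation_sq (hf.sub_const c).aestronglyMeasurable).trans ?_
  simp only [Pi.pow_apply]
  rw [integral_eq_lintegral_of_nonneg_ae (ae_of_all _ fun x => sq_nonneg _)
    ((hf.sub_const c).pow_const 2).aestronglyMeasurable]
  exact ENNReal.toReal_le_of_le_ofReal hb h

/-- Variance of a real linear functional of the trace of the propagator. -/
theorem variance_trace_propagator_le [IsProbabilityMeasure μ]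
    (hiso : IsNormalizedIsotropic μ) (hunc : IsUnconditional μ) (h : FourthMomentBounds μ C)
    (hC : 0 ≤ C) (hn : 2 ≤ n) (τ : Fin m → ℝ) (t : ℝ) (l : ℂ →L[ℝ] ℝ) (hl : ∀ z, |l z| ≤ ‖z‖) :
    variance (fun Y : Fin m → Fin k → Fin n → ℝ => l (propagator (tensorCov τ Y) t).trace)
      (Measure.pi fun _ : Fin m => Measure.pi fun _ : Fin k => μ) ≤
      ∑ α, 64 * tensorQuadConst C k * (2 * (t * τ α) ^ 2 + (t * τ α) ^ 4) / n := by
  have hD := tensorQuadConst_nonneg hC k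
  have hmeas : Measurable fun Y : Fin m → Fin k → Fin n → ℝ =>
      l (propagator (tensorCov τ Y) t).trace :=
    (l.continuous.comp ((continuous_trace_propagator τ).comp
      (continuous_const.prodMk continuous_id))).measurable
  refine variance_pi_le (K := Fintype.card (Fin k → Fin n)) hmeas
    (fun Y => (hl _).trans (norm_trace_propagator_le (tensorCov_isHermitian τ Y) t)) ?_
  intro α Y
  have hscale : ∀ Y : Fin m → Fin k → Fin n → ℝ, propagator (tensorCov τ Y) t =
      propagator (tensorCov (fun α => t * τ α) Y) 1 := fun Y => by
    rw [propagator_ofReal_eq, smul_tensorCov]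
  simp only [hscale]
  simp only [tensorCov_update]
  obtain ⟨c, hc⟩ := exists_lintegral_trace_propagator_sub_sq_le (k := k) hiso hunc h hC hn
    (tensorCov_isHermitian (Function.update (fun α => t * τ α) α 0) Y) (t * τ α)
  refine variance_le_of_lintegral_sub_sq_le (c := l c) ?_ (by positivity) (le_trans ?_ hc)
  · have := hmeas.comp (measurable_update Y (a := α))
    simp only [Function.comp_def, hscale] at this
    simpa only [tensorCov_update] using this
  · refine lintegral_mono fun y => ENNReal.ofReal_le_ofReal ?_
    rw [← map_sub, ← sq_abs]
    gcongr
    exact hl _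

/-- The mean square deviation of the trace of the propagator. -/
theorem lintegral_trace_propagator_sub_mean_le [IsProbabilityMeasure μ]
    (hiso : IsNormalizedIsotropic μ) (hunc : IsUnconditional μ) (h : FourthMomentBounds μ C)
    (hC : 0 ≤ C) (hn : 2 ≤ n) (τ : Fin m → ℝ) (t : ℝ) :
    ∫⁻ Y, ‖(propagator (tensorCov τ Y) t).trace - ∫ Y', (propagator (tensorCov τ Y') t).trace
          ∂(Measure.pi fun _ : Fin m => Measure.pi fun _ : Fin k => μ)‖ₑ ^ 2
        ∂(Measure.pi fun _ : Fin m => Measure.pi fun _ : Fin k => μ) ≤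
      ENNReal.ofReal
        (∑ α, 128 * tensorQuadConst C k * (2 * (t * τ α) ^ 2 + (t * τ α) ^ 4) / n) := by
  set ρ := Measure.pi fun _ : Fin m => Measure.pi fun _ : Fin k => μ
  set u : (Fin m → Fin k → Fin n → ℝ) → ℂ := fun Y => (propagator (tensorCov τ Y) t).trace with hu
  have hum : Measurable u :=
    ((continuous_trace_propagator τ).comp (continuous_const.prodMk continuous_id)).measurable
  have hub : ∀ Y, ‖u Y‖ ≤ Fintype.card (Fin k → Fin n) := fun Y =>
    norm_trace_propagator_le (tensorCov_isHermitian τ Y) t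
  have hui : Integrable u ρ := Integrable.of_bound hum.aestronglyMeasurable _ (ae_of_all _ hub)
  have hre := variance_trace_propagator_le (k := k) hiso hunc h hC hn τ t Complex.reCLM
    Complex.abs_re_le_norm
  have him := variance_trace_propagator_le (k := k) hiso hunc h hC hn τ t Complex.imCLM
    Complex.abs_im_le_norm
  have hrem : Measurable fun Y => (u Y).re := Complex.measurable_re.comp hum
  have himm : Measurable fun Y => (u Y).im := Complex.measurable_im.comp hum
  have hre2 : MemLp (fun Y => (u Y).re) 2 ρ := hrem.memLp_two_of_abs_le fun Y =>
    (Complex.abs_re_le_norm _).trans (hub Y)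
  have him2 : MemLp (fun Y => (u Y).im) 2 ρ := himm.memLp_two_of_abs_le fun Y =>
    (Complex.abs_im_le_norm _).trans (hub Y)
  have hsplit : ∀ Y, ‖u Y - ∫ Y', u Y' ∂ρ‖ₑ ^ 2 = ‖(u Y).re - ∫ Y', (u Y').re ∂ρ‖ₑ ^ 2 +
      ‖(u Y).im - ∫ Y', (u Y').im ∂ρ‖ₑ ^ 2 := by
    intro Y
    have e1 : (∫ Y', u Y' ∂ρ).re = ∫ Y', (u Y').re ∂ρ :=
      (Complex.reCLM.integral_comp_comm hui).symm
    have e2 : (∫ Y', u Y' ∂ρ).im = ∫ Y', (u Y').im ∂ρ :=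
      (Complex.imCLM.integral_comp_comm hui).symm
    rw [← e1, ← e2, ← Complex.sub_re, ← Complex.sub_im]
    set z := u Y - ∫ Y', u Y' ∂ρ
    simp only [← ofReal_norm, ← ENNReal.ofReal_pow (norm_nonneg _)]
    rw [← ENNReal.ofReal_add (by positivity) (by positivity), Real.norm_eq_abs, Real.norm_eq_abs,
      sq_abs, sq_abs, Complex.sq_norm, Complex.normSq_apply]
    congr 1
    ring
  calc _ = ∫⁻ Y, (‖(u Y).re - ∫ Y', (u Y').re ∂ρ‖ₑ ^ 2 +
        ‖(u Y).im - ∫ Y', (u Y').im ∂ρ‖ₑ ^ 2) ∂ρ := lintegral_congr hsplit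
    _ = evariance (fun Y => (u Y).re) ρ + evariance (fun Y => (u Y).im) ρ := by
      rw [lintegral_add_left ((hrem.sub_const _).enorm.pow_const 2)]
      rfl
    _ = ENNReal.ofReal (variance (fun Y => (u Y).re) ρ) +
        ENNReal.ofReal (variance (fun Y => (u Y).im) ρ) := by
      rw [hre2.ofReal_variance_eq, him2.ofReal_variance_eq]
    _ ≤ ENNReal.ofReal
          (∑ α, 64 * tensorQuadConst C k * (2 * (t * τ α) ^ 2 + (t * τ α) ^ 4) / n) +
        ENNReal.ofReal
          (∑ α, 64 * tensorQuadConst C k * (2 * (t * τ α) ^ 2 + (t * τ α) ^ 4) / n) :=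
      add_le_add (ENNReal.ofReal_le_ofReal hre) (ENNReal.ofReal_le_ofReal him)
    _ = _ := by
      have := tensorQuadConst_nonneg hC k
      rw [← ENNReal.ofReal_add (by positivity) (by positivity), ← Finset.sum_add_distrib]
      congr 1
      refine Finset.sum_congr rfl fun α _ => ?_
      ring

end TraceVariance

/-! ### Pointwise Fourier inversion in the Sobolev space -/

section FourierInversion

open scoped FourierTransform SchwartzMap ContDiff

/-- With the pairing of opposite sign, general facts on Fourier integrals become facts on the
inverse transform. -/
theorem vectorFourier_neg_inner_eq_fourierInv (f : ℝ → ℂ) :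
    VectorFourier.fourierIntegral Real.fourierChar volume (-innerₗ ℝ) f = 𝓕⁻ f := by
  ext w
  simp [VectorFourier.fourierIntegral, Real.fourierInv_eq]

theorem integral_fourierInv_smul_eq_of_integrable {f g : ℝ → ℂ} (hf : Integrable f)
    (hg : Integrable g) : ∫ x, 𝓕⁻ f x • g x = ∫ x, f x • 𝓕⁻ g x := by
  have h := VectorFourier.integral_fourierIntegral_smul_eq_flip (L := -innerₗ ℝ)
    Real.continuous_fourierChar (by simpa using! continuous_inner.neg) hf hg
  have hflip : (-innerₗ ℝ : ℝ →ₗ[ℝ] ℝ →ₗ[ℝ] ℝ).flip = -innerₗ ℝ := by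
    ext; simp
  rwa [hflip, vectorFourier_neg_inner_eq_fourierInv, vectorFourier_neg_inner_eq_fourierInv] at h

theorem continuous_fourierInv_of_integrable {g : ℝ → ℂ} (hg : Integrable g) :
    Continuous (𝓕⁻ g) := by
  rw [← vectorFourier_neg_inner_eq_fourierInv]
  exact VectorFourier.fourierIntegral_continuous Real.continuous_fourierChar
    (by simpa using! continuous_inner.neg) hg

/-- Fourier inversion for a square integrable function with integrable Fourier transform. -/
theorem ae_eq_fourierInv_of_integrable_fourier (f : Lp ℂ 2 (volume : Measure ℝ))
    (hg : Integrable (𝓕 f : Lp ℂ 2 (volume : Measure ℝ))) :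
    (f : ℝ → ℂ) =ᵐ[volume] 𝓕⁻ ((𝓕 f : Lp ℂ 2 (volume : Measure ℝ)) : ℝ → ℂ) := by
  refine ae_eq_of_integral_contDiff_smul_eq ?_ ?_ ?_
  · exact (Lp.memLp f).locallyIntegrable one_le_two
  · exact (continuous_fourierInv_of_integrable hg).locallyIntegrable
  intro ψ hψ hsupp
  have hsupp' : HasCompactSupport fun x => (ψ x : ℂ) := hsupp.comp_left Complex.ofReal_zero
  set Ψ : 𝓢(ℝ, ℂ) := hsupp'.toSchwartzMap (Complex.ofRealCLM.contDiff.comp hψ)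
  have hΨ : ∀ x, Ψ x = (ψ x : ℂ) := fun x => rfl
  -- Inversion holds for tempered distributions; integrability of the transform then lets 𝓕⁻ be
  -- moved off the test function.
  have h1 : 𝓕⁻ (Lp.toTemperedDistribution (𝓕 f)) Ψ = Lp.toTemperedDistribution f Ψ := by
    rw [Lp.fourierInv_toTemperedDistribution_eq, FourierTransform.fourierInv_fourier_eq]
  rw [TemperedDistribution.fourierInv_apply, Lp.toTemperedDistribution_apply,
    Lp.toTemperedDistribution_apply, SchwartzMap.fourierInv_coe,
    integral_fourierInv_smul_eq_of_integrable Ψ.integrable hg] at h1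
  simp only [hΨ] at h1
  simpa using h1.symm

theorem integrable_one_add_abs_rpow_neg {r : ℝ} (hr : 1 < r) :
    Integrable fun t : ℝ => (1 + |t|) ^ (-r) := by
  simpa using integrable_one_add_norm (E := ℝ) (μ := volume) (r := r) (by simpa using hr)

theorem stronglyMeasurable_fourierHat {φ : ℝ → ℝ}
    (hφ : MemLp (fun x => (φ x : ℂ)) 2 (volume : Measure ℝ)) :
    StronglyMeasurable (fourierHat φ hφ) :=
  (Lp.stronglyMeasurable _).comp_measurable (by fun_prop)

/-- With p = (1 + |t|)^s one has |φ̂| = p⁻¹ · p|φ̂| ≤ p⁻² + p²|φ̂|², and p⁻² is integrable because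
2s > 1. -/
theorem MemSobolevH.integrable_fourierHat {s : ℝ} (hs : 1 / 2 < s) {φ : ℝ → ℝ}
    (hφ : MemSobolevH s φ) : Integrable (fourierHat φ hφ.memLp) := by
  refine ((integrable_one_add_abs_rpow_neg (r := 2 * s) (by linarith)).add hφ.integrable).mono'
    (stronglyMeasurable_fourierHat _).aestronglyMeasurable (ae_of_all _ fun t => ?_)
  have ht : 0 < 1 + |t| := by positivity
  set a := ‖fourierHat φ hφ.memLp t‖
  set p := (1 + |t|) ^ s with hp
  have hp0 : 0 < p := Real.rpow_pos_of_pos ht s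
  have e1 : (1 + |t|) ^ (2 * s) = p ^ 2 := by
    rw [hp, ← Real.rpow_natCast, ← Real.rpow_mul ht.le, mul_comm]
    norm_num
  have e2 : (1 + |t|) ^ (-(2 * s)) = (p⁻¹) ^ 2 := by
    rw [Real.rpow_neg ht.le, e1, inv_pow]
  simp only [Pi.add_apply]
  rw [e1, e2]
  have : a = p⁻¹ * (p * a) := by field_simp
  nlinarith [sq_nonneg (p⁻¹ - p * a), sq_nonneg p⁻¹, sq_nonneg (p * a)]

/-- Pointwise Fourier inversion in the Sobolev space. -/
theorem MemSobolevH.eq_integral_fourierHat {s : ℝ} (hs : 1 / 2 < s) {φ : ℝ → ℝ}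
    (hφ : MemSobolevH s φ) (x : ℝ) :
    (φ x : ℂ) = (2 * Real.pi : ℂ)⁻¹ *
      ∫ t : ℝ, Complex.exp (((-t : ℝ) : ℂ) * (Complex.I * x)) * fourierHat φ hφ.memLp t := by
  set f : Lp ℂ 2 (volume : Measure ℝ) := hφ.memLp.toLp (fun x => (φ x : ℂ)) with hf
  set g : Lp ℂ 2 (volume : Measure ℝ) := 𝓕 f with hg
  have hpi : (2 * Real.pi) ≠ 0 := by positivity
  have hscale : ∀ F : ℝ → ℂ, ∫ t : ℝ, F (-t / (2 * Real.pi)) = (2 * Real.pi : ℂ) * ∫ w, F w := by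
    intro F
    have h := Measure.integral_comp_mul_left F (-(2 * Real.pi)⁻¹)
    have e : ∀ t : ℝ, -(2 * Real.pi)⁻¹ * t = -t / (2 * Real.pi) := fun t => by field_simp
    simp only [e] at h
    rw [h, inv_neg, inv_inv, abs_neg, abs_of_pos (by positivity)]
    simp
  have hgint : Integrable (g : ℝ → ℂ) := by
    have h := (hφ.integrable_fourierHat hs).comp_mul_left' (R := -(2 * Real.pi)) (by simp)
    refine h.congr (ae_of_all _ fun t => ?_)
    simp only [fourierHat]
    congr 1
    field_simp
  have hae : (fun x => (φ x : ℂ)) =ᵐ[volume] 𝓕⁻ (g : ℝ → ℂ) :=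
    hφ.memLp.coeFn_toLp.symm.trans (ae_eq_fourierInv_of_integrable_fourier f hgint)
  -- Both sides are continuous, so equality almost everywhere upgrades to every point; this matters
  -- since φ is evaluated at eigenvalues.
  have heq : (fun x => (φ x : ℂ)) = 𝓕⁻ (g : ℝ → ℂ) :=
    (Continuous.ae_eq_iff_eq volume (Complex.continuous_ofReal.comp hφ.continuous)
      (continuous_fourierInv_of_integrable hgint)).1 hae
  have hx := congrFun heq x
  rw [hx, Real.fourierInv_eq']
  have h2 := hscale fun w => Complex.exp ((2 * Real.pi * w * x : ℝ) * Complex.I) * g w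
  have h3 : ∀ t : ℝ, Complex.exp (((-t : ℝ) : ℂ) * (Complex.I * x)) * fourierHat φ hφ.memLp t =
      Complex.exp ((2 * Real.pi * (-t / (2 * Real.pi)) * x : ℝ) * Complex.I) *
        g (-t / (2 * Real.pi)) := by
    intro t
    congr 2
    rw [mul_div_cancel₀ _ hpi]
    push_cast
    ring
  simp only [h3]
  rw [h2, ← mul_assoc, inv_mul_cancel₀ (by exact_mod_cast hpi), one_mul]
  congr 1
  ext w
  rw [smul_eq_mul]
  congr 3
  simp
  ring

end FourierInversion

/-! ### From traces of the propagator to linear eigenvalue statistics -/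

section SobolevBound

theorem sq_lintegral_mul_le {X : Type*} [MeasurableSpace X] {ν : Measure X} {f g : X → ENNReal}
    (hf : AEMeasurable f ν) (hg : AEMeasurable g ν) :
    (∫⁻ x, f x * g x ∂ν) ^ 2 ≤ (∫⁻ x, f x ^ 2 ∂ν) * ∫⁻ x, g x ^ 2 ∂ν := by
  have h := ENNReal.lintegral_mul_le_Lp_mul_Lq ν (p := 2) (q := 2)
    Real.HolderConjugate.two_two hf hg
  calc _ ≤ ((∫⁻ x, f x ^ (2 : ℝ) ∂ν) ^ (1 / 2 : ℝ) *
        (∫⁻ x, g x ^ (2 : ℝ) ∂ν) ^ (1 / 2 : ℝ)) ^ 2 := by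
        gcongr
        exact h
    _ = _ := by
        rw [mul_pow, ← ENNReal.rpow_natCast, ← ENNReal.rpow_natCast, ← ENNReal.rpow_mul,
          ← ENNReal.rpow_mul]
        norm_num

/-- Weighted Cauchy-Schwarz inequality. -/
theorem sq_lintegral_mul_le_weighted {X : Type*} [MeasurableSpace X] {ν : Measure X}
    {f g w : X → ENNReal} (hf : Measurable f) (hg : Measurable g) (hw : Measurable w)
    (hw0 : ∀ x, w x ≠ 0) (hwt : ∀ x, w x ≠ ⊤) :
    (∫⁻ x, f x * g x ∂ν) ^ 2 ≤
      (∫⁻ x, w x ^ 2 * f x ^ 2 ∂ν) * ∫⁻ x, (w x ^ 2)⁻¹ * g x ^ 2 ∂ν := by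
  have h := sq_lintegral_mul_le (ν := ν) (hw.mul hf).aemeasurable (hw.inv.mul hg).aemeasurable
  simp only [Pi.mul_apply, Pi.inv_apply, mul_pow, ← ENNReal.inv_pow] at h
  convert h using 3
  ext x
  rw [mul_mul_mul_comm, ENNReal.mul_inv_cancel (hw0 x) (hwt x), one_mul]

variable {k m n : ℕ}

/-- Linear eigenvalue statistics in terms of the traces of the propagators. -/
theorem MemSobolevH.linearStat_eq {s : ℝ} (hs : 1 / 2 < s) {φ : ℝ → ℝ} (hφ : MemSobolevH s φ)
    (τ : Fin m → ℝ) (Y : Fin m → Fin k → Fin n → ℝ) :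
    (linearStat φ τ Y : ℂ) = (2 * Real.pi : ℂ)⁻¹ *
      ∫ t : ℝ, (propagator (tensorCov τ Y) ((-t : ℝ) : ℂ)).trace * fourierHat φ hφ.memLp t := by
  simp only [linearStat, Complex.ofReal_sum, hφ.eq_integral_fourierHat hs,
    trace_propagator (tensorCov_isHermitian τ Y), Finset.sum_mul]
  rw [integral_finsetSum, Finset.mul_sum]
  intro j _
  refine (hφ.integrable_fourierHat hs).bdd_mul (c := 1) ?_ (ae_of_all _ fun t => ?_)
  · exact Continuous.aestronglyMeasurable (by fun_prop)
  · exact (norm_exp_real_mul_I _ _).le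

theorem measurable_integral_mul_of_continuous {X : Type*} [MeasurableSpace X] [TopologicalSpace X]
    [OpensMeasurableSpace (ℝ × X)] {u : ℝ × X → ℂ} (hu : Continuous u) {g : ℝ → ℂ}
    (hg : Measurable g) : Measurable fun x => ∫ t : ℝ, u (-t, x) * g t := by
  have h1 : Measurable fun p : X × ℝ => u (-p.2, p.1) :=
    hu.measurable.comp (measurable_snd.neg.prodMk measurable_fst)
  have h2 : Measurable fun p : X × ℝ => u (-p.2, p.1) * g p.2 := h1.mul (hg.comp measurable_snd)
  exact (h2.stronglyMeasurable.integral_prod_right' (ν := volume)).measurable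

/-- The Fourier representation exhibits the statistic as a parameter integral of a jointly
continuous trace against φ̂, so measurability of individual eigenvalues is never needed. -/
theorem MemSobolevH.measurable_linearStat {s : ℝ} (hs : 1 / 2 < s) {φ : ℝ → ℝ}
    (hφ : MemSobolevH s φ) (τ : Fin m → ℝ) :
    Measurable fun Y : Fin m → Fin k → Fin n → ℝ => linearStat φ τ Y := by
  have h := (measurable_integral_mul_of_continuous (continuous_trace_propagator (k := k) (n := n) τ)
    (stronglyMeasurable_fourierHat hφ.memLp).measurable).const_mul ((2 * Real.pi : ℂ)⁻¹)
  have h' : (fun Y : Fin m → Fin k → Fin n → ℝ => linearStat φ τ Y) = fun Y =>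
      ((linearStat φ τ Y : ℝ) : ℂ).re := funext fun Y => (Complex.ofReal_re _).symm
  rw [h']
  refine Complex.measurable_re.comp ?_
  rw [funext fun Y : Fin m → Fin k → Fin n → ℝ => hφ.linearStat_eq hs τ Y]
  exact h

theorem MemSobolevH.abs_linearStat_le {s : ℝ} (hs : 1 / 2 < s) {φ : ℝ → ℝ} (hφ : MemSobolevH s φ)
    (τ : Fin m → ℝ) (Y : Fin m → Fin k → Fin n → ℝ) :
    |linearStat φ τ Y| ≤ ‖(2 * Real.pi : ℂ)⁻¹‖ *
      ∫ t : ℝ, Fintype.card (Fin k → Fin n) * ‖fourierHat φ hφ.memLp t‖ := by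
  rw [← Real.norm_eq_abs, ← Complex.norm_real, hφ.linearStat_eq hs, norm_mul]
  gcongr
  refine norm_integral_le_of_norm_le ((hφ.integrable_fourierHat hs).norm.const_mul _)
    (ae_of_all _ fun t => ?_)
  rw [norm_mul]
  gcongr
  exact norm_trace_propagator_le (tensorCov_isHermitian τ Y) _

variable {μ : Measure (Fin n → ℝ)} {C : ℝ}

/-- The variance bound for linear eigenvalue statistics in fixed dimension. -/
theorem MemSobolevH.variance_linearStat_le [IsProbabilityMeasure μ]
    (hiso : IsNormalizedIsotropic μ) (hunc : IsUnconditional μ) (h : FourthMomentBounds μ C)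
    (hC : 0 ≤ C) (hn : 2 ≤ n) (τ : Fin m → ℝ) {s : ℝ} (hs : 5 / 2 < s) {φ : ℝ → ℝ}
    (hφ : MemSobolevH s φ) :
    variance (fun Y : Fin m → Fin k → Fin n → ℝ => linearStat φ τ Y)
        (Measure.pi fun _ : Fin m => Measure.pi fun _ : Fin k => μ) ≤
      sobolevNormSq s φ hφ.memLp *
        ((∑ α, 128 * tensorQuadConst C k * (2 * τ α ^ 2 + τ α ^ 4) / n) *
          ∫ t : ℝ, (1 + |t|) ^ (-(2 * s - 4))) := by
  have hs' : 1 / 2 < s := by linarith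
  have hD := tensorQuadConst_nonneg hC k
  set ρ := Measure.pi fun _ : Fin m => Measure.pi fun _ : Fin k => μ with hρ
  set T := ∑ α, 128 * tensorQuadConst C k * (2 * τ α ^ 2 + τ α ^ 4) / n with hT
  have hT0 : 0 ≤ T := by positivity
  set u : ℝ → (Fin m → Fin k → Fin n → ℝ) → ℂ := fun t Y =>
    (propagator (tensorCov τ Y) ((-t : ℝ) : ℂ)).trace with hu
  have hum : Continuous fun p : ℝ × (Fin m → Fin k → Fin n → ℝ) => u p.1 p.2 :=
    (continuous_trace_propagator τ).comp (continuous_fst.neg.prodMk continuous_snd)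
  have hub : ∀ t Y, ‖u t Y‖ ≤ Fintype.card (Fin k → Fin n) := fun t Y =>
    norm_trace_propagator_le (tensorCov_isHermitian τ Y) _
  set e : ℝ → ℂ := fun t => ∫ Y, u t Y ∂ρ with he
  have hem : Measurable e := (hum.measurable.stronglyMeasurable.integral_prod_right').measurable
  have heb : ∀ t, ‖e t‖ ≤ Fintype.card (Fin k → Fin n) := fun t => by
    simpa using norm_integral_le_of_norm_le_const (μ := ρ) (ae_of_all _ (hub t))
  set φh := fourierHat φ hφ.memLp with hφh
  have hφm : Measurable φh := (stronglyMeasurable_fourierHat _).measurable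
  have hφi : Integrable φh := hφ.integrable_fourierHat hs'
  -- This is formally the mean of the statistic, but it only has to be some constant.
  set c : ℂ := (2 * Real.pi : ℂ)⁻¹ * ∫ t, e t * φh t with hc
  set w : ℝ → ENNReal := fun t => ENNReal.ofReal ((1 + |t|) ^ s) with hw
  have hpos : ∀ t : ℝ, 0 < 1 + |t| := fun t => by positivity
  have hw2 : ∀ t, w t ^ 2 = ENNReal.ofReal ((1 + |t|) ^ (2 * s)) := fun t => by
    rw [hw, ← ENNReal.ofReal_pow (by positivity), ← Real.rpow_natCast, ← Real.rpow_mul (hpos t).le,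
      mul_comm]
    norm_num
  have hw2i : ∀ t, (w t ^ 2)⁻¹ = ENNReal.ofReal ((1 + |t|) ^ (-(2 * s))) := fun t => by
    rw [hw2, ← ENNReal.ofReal_inv_of_pos (by have := hpos t; positivity), Real.rpow_neg (hpos t).le]
  have hwm : Measurable w := by
    have : Measurable fun t : ℝ => (1 + |t|) ^ s := by fun_prop
    exact this.ennreal_ofReal
  have hsob : ∫⁻ t, w t ^ 2 * ‖φh t‖ₑ ^ 2 = ENNReal.ofReal (sobolevNormSq s φ hφ.memLp) := by
    rw [sobolevNormSq, ofReal_integral_eq_lintegral_ofReal hφ.integrable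
      (ae_of_all _ fun t => by have := hpos t; positivity)]
    refine lintegral_congr fun t => ?_
    rw [hw2, ENNReal.ofReal_mul (by have := hpos t; positivity),
      ENNReal.ofReal_pow (norm_nonneg _), ofReal_norm]
  have hpt : ∀ Y, ENNReal.ofReal ((linearStat φ τ Y - c.re) ^ 2) ≤
      ENNReal.ofReal (sobolevNormSq s φ hφ.memLp) *
        ∫⁻ t, (w t ^ 2)⁻¹ * ‖u t Y - e t‖ₑ ^ 2 := by
    intro Y
    have hi1 : Integrable fun t => u t Y * φh t := hφi.bdd_mul
      (c := Fintype.card (Fin k → Fin n))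
      (hum.comp (continuous_id.prodMk continuous_const)).aestronglyMeasurable
      (ae_of_all _ fun t => hub t Y)
    have hi2 : Integrable fun t => e t * φh t := hφi.bdd_mul
      (c := Fintype.card (Fin k → Fin n)) hem.aestronglyMeasurable (ae_of_all _ heb)
    have hdiff : (linearStat φ τ Y : ℂ) - c =
        (2 * Real.pi : ℂ)⁻¹ * ∫ t, φh t * (u t Y - e t) := by
      rw [hφ.linearStat_eq hs', hc, ← mul_sub, ← integral_sub hi1 hi2]
      congr 2
      ext t
      ring
    have hpi : ‖(2 * Real.pi : ℂ)⁻¹‖ₑ ≤ 1 := by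
      rw [← ofReal_norm, ENNReal.ofReal_le_one, norm_inv]
      apply inv_le_one_of_one_le₀
      rw [norm_mul, Complex.norm_real, Real.norm_eq_abs, abs_of_pos Real.pi_pos]
      norm_num
      linarith [Real.pi_gt_three]
    have hre : ENNReal.ofReal ((linearStat φ τ Y - c.re) ^ 2) ≤
        ‖(linearStat φ τ Y : ℂ) - c‖ₑ ^ 2 := by
      rw [← ofReal_norm, ← ENNReal.ofReal_pow (norm_nonneg _)]
      apply ENNReal.ofReal_le_ofReal
      rw [← sq_abs]
      gcongr
      simpa using Complex.abs_re_le_norm ((linearStat φ τ Y : ℂ) - c)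
    calc _ ≤ ‖(linearStat φ τ Y : ℂ) - c‖ₑ ^ 2 := hre
      _ ≤ (∫⁻ t, ‖φh t‖ₑ * ‖u t Y - e t‖ₑ) ^ 2 := by
          gcongr
          rw [hdiff, enorm_mul]
          refine (mul_le_mul' hpi (enorm_integral_le_lintegral_enorm _)).trans (le_of_eq ?_)
          simp only [one_mul, enorm_mul]
      _ ≤ (∫⁻ t, w t ^ 2 * ‖φh t‖ₑ ^ 2) * ∫⁻ t, (w t ^ 2)⁻¹ * ‖u t Y - e t‖ₑ ^ 2 := by
          refine sq_lintegral_mul_le_weighted hφm.enorm ?_ hwm (fun t => ?_)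
            fun t => ENNReal.ofReal_ne_top
          · exact ((hum.comp (continuous_id.prodMk continuous_const)).measurable.sub hem).enorm
          · have := hpos t
            simp only [hw, ne_eq, ENNReal.ofReal_eq_zero, not_le]
            positivity
      _ = _ := by rw [hsob]
  -- The trace has mean square deviation quadratic plus quartic in t; the weight (1 + |t|)⁴
  -- dominates both.
  have hdev : ∀ t, ∫⁻ Y, ‖u t Y - e t‖ₑ ^ 2 ∂ρ ≤ ENNReal.ofReal ((1 + |t|) ^ 4 * T) := by
    intro t
    refine (lintegral_trace_propagator_sub_mean_le (k := k) hiso hunc h hC hn τ (-t)).trans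
      (ENNReal.ofReal_le_ofReal ?_)
    rw [hT, Finset.mul_sum]
    refine Finset.sum_le_sum fun α _ => ?_
    rw [← mul_div_assoc]
    refine div_le_div_of_nonneg_right ?_ (Nat.cast_nonneg n)
    have h1 : t ^ 2 ≤ (1 + |t|) ^ 4 := by
      rw [← sq_abs]
      nlinarith [abs_nonneg t, pow_nonneg (abs_nonneg t) 3, pow_nonneg (abs_nonneg t) 4]
    have h2 : t ^ 4 ≤ (1 + |t|) ^ 4 := by
      rw [← Even.pow_abs (by decide : Even 4) t]
      gcongr
      linarith
    have h3 : 2 * (-t * τ α) ^ 2 + (-t * τ α) ^ 4 ≤ (1 + |t|) ^ 4 * (2 * τ α ^ 2 + τ α ^ 4) := by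
      have h4 := mul_le_mul_of_nonneg_right h1 (sq_nonneg (τ α))
      have h5 := mul_le_mul_of_nonneg_right h2 (by positivity : 0 ≤ τ α ^ 4)
      calc _ = 2 * (t ^ 2 * τ α ^ 2) + t ^ 4 * τ α ^ 4 := by ring
        _ ≤ 2 * ((1 + |t|) ^ 4 * τ α ^ 2) + (1 + |t|) ^ 4 * τ α ^ 4 := by linarith
        _ = _ := by ring
    calc _ ≤ 128 * tensorQuadConst C k * ((1 + |t|) ^ 4 * (2 * τ α ^ 2 + τ α ^ 4)) :=
          mul_le_mul_of_nonneg_left h3 (by positivity)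
      _ = _ := by ring
  have hjm : Measurable fun p : (Fin m → Fin k → Fin n → ℝ) × ℝ =>
      (w p.2 ^ 2)⁻¹ * ‖u p.2 p.1 - e p.2‖ₑ ^ 2 := by
    have h1 : Measurable fun p : (Fin m → Fin k → Fin n → ℝ) × ℝ => u p.2 p.1 - e p.2 :=
      (hum.comp continuous_swap).measurable.sub (hem.comp measurable_snd)
    exact ((hwm.comp measurable_snd).pow_const 2).inv.mul (h1.enorm.pow_const 2)
  -- The condition 2s - 4 > 1 is exactly s > 5/2.
  have hIint : Integrable fun t : ℝ => (1 + |t|) ^ (-(2 * s - 4)) :=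
    integrable_one_add_abs_rpow_neg (by linarith)
  have hI0 : 0 ≤ ∫ t : ℝ, (1 + |t|) ^ (-(2 * s - 4)) :=
    integral_nonneg fun t => by have := hpos t; positivity
  have hN0 : 0 ≤ sobolevNormSq s φ hφ.memLp :=
    integral_nonneg fun t => by have := hpos t; positivity
  refine variance_le_of_lintegral_sub_sq_le (c := c.re) (hφ.measurable_linearStat hs' τ)
    (by positivity) ((lintegral_mono hpt).trans ?_)
  rw [lintegral_const_mul' _ _ ENNReal.ofReal_ne_top, ENNReal.ofReal_mul hN0,
    lintegral_lintegral_swap hjm.aemeasurable]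
  gcongr
  rw [← integral_const_mul, ofReal_integral_eq_lintegral_ofReal (hIint.const_mul T)
    (ae_of_all _ fun t => by have := hpos t; positivity)]
  refine lintegral_mono fun t => ?_
  have hm1 : Measurable fun Y => ‖u t Y - e t‖ₑ ^ 2 :=
    ((hum.comp (continuous_const.prodMk continuous_id)).measurable.sub_const _).enorm.pow_const 2
  rw [lintegral_const_mul _ hm1, hw2i]
  calc _ ≤ ENNReal.ofReal ((1 + |t|) ^ (-(2 * s))) * ENNReal.ofReal ((1 + |t|) ^ 4 * T) := by
        gcongr
        exact hdev t
    _ = _ := by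
        rw [← ENNReal.ofReal_mul (by have := hpos t; positivity)]
        congr 1
        have : (1 + |t|) ^ (-(2 * s - 4)) = (1 + |t|) ^ (-(2 * s)) * (1 + |t|) ^ 4 := by
          rw [← Real.rpow_natCast (1 + |t|) 4, ← Real.rpow_add (hpos t)]
          congr 1
          push_cast
          ring
        rw [this]
        ring

end SobolevBound

/-! ### Transfer to the given random variables and conclusion -/

section IndependentCopies

/-- Independent copies indexed by pairs have the iterated product as their joint law. -/
theorem map_eq_pi_pi_of_iIndepFun {ι κ Ω X : Type*} [Fintype ι] [Fintype κ] [MeasurableSpace Ω]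
    [MeasurableSpace X] {P : Measure Ω} {μ : Measure X} [IsProbabilityMeasure μ]
    {y : ι → κ → Ω → X} (hlaw : ∀ i j, HasLaw (y i j) μ P)
    (hindep : iIndepFun (fun p : ι × κ => y p.1 p.2) P) :
    P.map (fun ω i j => y i j ω) = Measure.pi fun _ : ι => Measure.pi fun _ : κ => μ := by
  have hpair : P.map (fun ω (p : ι × κ) => y p.1 p.2 ω) = Measure.pi fun _ : ι × κ => μ := by
    rw [hindep.map_fun_eq_pi_map fun p : ι × κ => (hlaw p.1 p.2).aemeasurable]
    simp only [(hlaw _ _).map_eq]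
  have hae : AEMeasurable (fun ω (p : ι × κ) => y p.1 p.2 ω) P :=
    aemeasurable_pi_iff.2 fun p => (hlaw p.1 p.2).aemeasurable
  have hcurry := Measure.infinitePi_map_curry (fun (_ : ι) (_ : κ) => μ)
  simp only [Measure.infinitePi_eq_pi] at hcurry
  rw [← hcurry, ← hpair,
    AEMeasurable.map_map_of_aemeasurable (MeasurableEquiv.measurable _).aemeasurable hae]
  rfl

end IndependentCopies

section CountingMeasure

theorem sum_pow_four_le_of_integral_le {M : ℕ} {x : Fin M → ℝ} {T : ℝ}
    (h : ∫ t, t ^ 4 ∂(normalizedCountingMeasure x) ≤ T) : ∑ α, x α ^ 4 ≤ M * T := by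
  rcases Nat.eq_zero_or_pos M with rfl | hM
  · simp
  rw [normalizedCountingMeasure, integral_smul_measure, integral_finsetSum_measure
    fun i _ => integrable_dirac (by simp)] at h
  simp only [integral_dirac, Fintype.card_fin, ENNReal.toReal_inv, ENNReal.toReal_natCast,
    smul_eq_mul] at h
  rwa [inv_mul_le_iff₀ (by exact_mod_cast hM)] at h

end CountingMeasure

theorem FourthMomentAsymptotics.exists_fourthMomentBounds {μ : ∀ n : ℕ, Measure (Fin n → ℝ)}
    (h : FourthMomentAsymptotics μ) :
    ∃ C : ℝ, 0 ≤ C ∧ ∀ᶠ n : ℕ in atTop, FourthMomentBounds (μ n) C := by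
  obtain ⟨C, hC⟩ := h
  refine ⟨max C 0, le_max_right _ _, hC.mono fun n hn => ⟨hn.1, fun i j hij => ?_, fun i j hij => ?_⟩⟩
  · refine (hn.2 i j hij).1.trans ?_
    rw [show (n : ℝ) ^ (-3 : ℤ) = ((n : ℝ) ^ 3)⁻¹ by rw [zpow_neg]; norm_cast]
    gcongr
    exact le_max_left _ _
  · refine (hn.2 i j hij).2.trans ?_
    rw [show (n : ℝ) ^ (-2 : ℤ) = ((n : ℝ) ^ 2)⁻¹ by rw [zpow_neg]; norm_cast]
    gcongr
    exact le_max_left _ _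

theorem lemmal
    -- the order of the tensor product, and the number of summands `m = m(n)`
    (k : ℕ) (hk : 1 ≤ k) (m : ℕ → ℕ) (c : ℝ) (hc : 0 < c)
    (hm : Tendsto m atTop atTop)
    (hmn : Tendsto (fun n : ℕ => (m n : ℝ) / (n : ℝ) ^ k) atTop (𝓝 c))
    -- the coefficients: weakly convergent counting measures, bounded fourth moments
    (τ : (M : ℕ) → Fin M → ℝ) (σ : Measure ℝ) [IsProbabilityMeasure σ]
    (hσ : ∀ f : BoundedContinuousFunction ℝ ℝ,
      Tendsto (fun M : ℕ => ∫ t, f t ∂(normalizedCountingMeasure (τ M))) atTop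
        (𝓝 (∫ t, f t ∂σ)))
    (hτ : BddAbove (Set.range fun M : ℕ => ∫ t, t ^ 4 ∂(normalizedCountingMeasure (τ M))))
    -- the law of the random vector in `ℝⁿ`
    (μ : (n : ℕ) → Measure (Fin n → ℝ)) [∀ n, IsProbabilityMeasure (μ n)]
    (hiso : ∀ n, IsNormalizedIsotropic (μ n))
    (hunc : ∀ n, IsUnconditional (μ n))
    (hmom : FourthMomentAsymptotics μ)
    -- its i.i.d. copies
    (Ω : ℕ → Type*) [∀ n, MeasurableSpace (Ω n)]
    (P : (n : ℕ) → Measure (Ω n)) [∀ n, IsProbabilityMeasure (P n)]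
    (y : (n : ℕ) → Fin (m n) → Fin k → Ω n → (Fin n → ℝ))
    (hlaw : ∀ n α j, HasLaw (y n α j) (μ n) (P n))
    (hindep : ∀ n, iIndepFun (fun p : Fin (m n) × Fin k => y n p.1 p.2) (P n))
    (s : ℝ) (hs : 5 / 2 < s) :
    ∃ C : ℝ, ∀ᶠ n : ℕ in atTop, ∀ (φ : ℝ → ℝ) (hφ : MemSobolevH s φ),
      MemLp (fun ω => linearStat φ (τ (m n)) (fun α j => y n α j ω)) 2 (P n) ∧
      variance (fun ω => linearStat φ (τ (m n)) (fun α j => y n α j ω)) (P n) ≤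
        C * (n : ℝ) ^ (k - 1) * sobolevNormSq s φ hφ.memLp := by
  obtain ⟨D, hD0, hD⟩ := hmom.exists_fourthMomentBounds
  obtain ⟨T, hT⟩ := hτ
  have hT' : ∀ M, ∫ t, t ^ 4 ∂(normalizedCountingMeasure (τ M)) ≤ T := fun M => hT ⟨M, rfl⟩
  have hT0 : 0 ≤ T := (integral_nonneg fun t => by positivity).trans (hT' 0)
  set A := 128 * tensorQuadConst D k with hA
  have hA0 : 0 ≤ A := mul_nonneg (by norm_num) (tensorQuadConst_nonneg hD0 k)
  set I := ∫ t : ℝ, (1 + |t|) ^ (-(2 * s - 4)) with hI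
  have hI0 : 0 ≤ I := integral_nonneg fun t => by positivity
  -- A and I come from the fixed-dimension bound, c + 1 from m ≤ (c + 1) n^k for large n, and 1 + 2T
  -- from 2τ² + τ⁴ ≤ 1 + 2τ⁴ with the fourth moment bound T.
  refine ⟨A * ((c + 1) * (1 + 2 * T)) * I, ?_⟩
  filter_upwards [hD, eventually_ge_atTop 2, hmn.eventually_le_const (lt_add_one c)]
    with n hDn hn hmc φ hφ
  have hs' : 1 / 2 < s := by linarith
  have hmap := map_eq_pi_pi_of_iIndepFun (hlaw n) (hindep n)
  have hae : AEMeasurable (fun ω α j => y n α j ω) (P n) :=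
    aemeasurable_pi_iff.2 fun α => aemeasurable_pi_iff.2 fun j => (hlaw n α j).aemeasurable
  have hmeas := hφ.measurable_linearStat (k := k) (n := n) hs' (τ (m n))
  refine ⟨?_, ?_⟩
  · exact MemLp.of_bound (hmeas.comp_aemeasurable hae).aestronglyMeasurable _
      (ae_of_all _ fun ω => hφ.abs_linearStat_le hs' (τ (m n)) fun α j => y n α j ω)
  have hvar := variance_map (X := fun Y => linearStat φ (τ (m n)) Y) hmeas.aemeasurable hae
  have hN0 : 0 ≤ sobolevNormSq s φ hφ.memLp := integral_nonneg fun t => by positivity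
  have hn0 : (0 : ℝ) < n := by exact_mod_cast (by omega : 0 < n)
  have hmn' : (m n : ℝ) ≤ (c + 1) * (n : ℝ) ^ k := (div_le_iff₀ (by positivity)).1 hmc
  have hsum : ∑ α, (2 * τ (m n) α ^ 2 + τ (m n) α ^ 4) ≤ m n * (1 + 2 * T) := by
    calc _ ≤ ∑ α : Fin (m n), (1 + 2 * τ (m n) α ^ 4) :=
          Finset.sum_le_sum fun α _ => by nlinarith [sq_nonneg (τ (m n) α ^ 2 - 1)]
      _ = m n + 2 * ∑ α, τ (m n) α ^ 4 := by
          rw [Finset.sum_add_distrib, Finset.mul_sum]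
          simp
      _ ≤ _ := by linarith [sum_pow_four_le_of_integral_le (hT' (m n))]
  calc variance (fun ω => linearStat φ (τ (m n)) fun α j => y n α j ω) (P n)
      = variance (fun Y => linearStat φ (τ (m n)) Y)
          (Measure.pi fun _ : Fin (m n) => Measure.pi fun _ : Fin k => μ n) := by
        rw [← hmap, hvar]
        rfl
    _ ≤ sobolevNormSq s φ hφ.memLp *
          ((∑ α, A * (2 * τ (m n) α ^ 2 + τ (m n) α ^ 4) / n) * I) :=
        hφ.variance_linearStat_le (hiso n) (hunc n) hDn hD0 hn (τ (m n)) hs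
    _ = sobolevNormSq s φ hφ.memLp *
          (A * (∑ α, (2 * τ (m n) α ^ 2 + τ (m n) α ^ 4)) / n * I) := by
        rw [Finset.mul_sum, Finset.sum_div]
    _ ≤ sobolevNormSq s φ hφ.memLp *
          (A * ((c + 1) * (n : ℝ) ^ k * (1 + 2 * T)) / n * I) := by
        gcongr
        exact hsum.trans (by gcongr)
    _ = _ := by
        -- Here k ≥ 1 makes the truncated exponent k - 1 the true one, so that n^k / n = n^{k-1}.
        obtain ⟨l, rfl⟩ : ∃ l, k = l + 1 := ⟨k - 1, by omega⟩
        rw [Nat.add_sub_cancel, pow_succ]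
        field_simp
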